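/- **Setting.** Let $\{\nu_\theta:\theta\in\Theta\}$ be a one-parameter canonical exponential family: $\Theta\subseteq\mathbb R$ is convex, $b:\Theta\to\mathbb R$ is strictly convex and twice differentiable, and $\nu_\theta$ is the probability measure with density $e^{x\theta-b(\theta)}$ with respect to a fixed reference measure $m$ on $\mathbb R$. Let $\mathcal I$ be the set of means of the $\nu_\theta$; for $\mu\in\mathcal I$ let $\nu^\mu$ be the member of the family with mean $\mu$, and let $d(\mu,\mu')=\mathrm{KL}(\nu^\mu,\nu^{\mu'})$. There are $K$ arms. In round $t\ge1$ an arm $A_t\in\{1,\dots,K\}$ is selected on the basis of the past $(A_s,X_s)_{s<t}$, possibly with additional randomisation (any sampling rule is allowed); then, conditionally on the past and on $A_t$, the sample $X_t$ has law $\nu^{\mu_{A_t}}$, where $\boldsymbol\mu=(\mu_1,\dots,\mu_K)$ is the vector of means. Let $N_a(t)$ be the number of selections of arm $a$ in the first $t$ rounds, and $\hat\mu_a(t)$ the empirical mean of arm $a$, which is defined once $N_a(t)\ge1$. An identification problem consists of pairwise disjoint sets $\mathcal O_1,\dots,\mathcal O_M\subseteq\mathcal I^K$ that are open in $\mathcal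 I^K$; put $\mathcal O=\bigcup_i\mathcal O_i$ and $\mathrm{Alt}(\boldsymbol\mu)=\bigcup_{i:\boldsymbol\mu\notin\mathcal O_i}\mathcal O_i$. It has *rank $R$* if there are a finite $Q$, arm indices $k^{i,q}_r\in\{1,\dots,K\}$ and open sets $\mathcal L_{i,q}\subseteq\mathbb R^R$ ($1\le i\le M$, $1\le q\le Q$, $1\le r\le R$) such that for every $i$ $$\mathcal O\setminus\mathcal O_i\;\subseteq\;\bigcup_{q=1}^Q\bigl\{\boldsymbol\lambda\in\mathcal I^K:(\lambda_{k^{i,q}_1},\dots,\lambda_{k^{i,q}_R})\in\mathcal L_{i,q}\bigr\}\;\subseteq\;\overline{\mathcal O\setminus\mathcal O_i};$$ this holds in particular when $\mathcal O\setminus\mathcal O_i$ equals the union. Given thresholds $\hat c_t(\delta)$, the extended GLR stopping rule $\tau_\delta$ is the first $t$ such that every arm has been sampled, $\hat{\boldsymbol\mu}(t)\in\mathcal O$, and $$\hat\Lambda_t=\inf_{\boldsymbol\lambda\in\mathrm{Alt}(\hat{\boldsymbol\mu}(t))}\sum_{a=1}^K N_a(t)\,d(\hat\mu_a(t),\lambda_a)>\hat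 c_t(\delta)$$ ($\inf\emptyset=\infty$, and $\tau_\delta=\infty$ if there is no such $t$). At $\tau_\delta$ it recommends the index $\hat\imath(\tau_\delta)$ with $\hat{\boldsymbol\mu}(\tau_\delta)\in\mathcal O_{\hat\imath(\tau_\delta)}$. Let $h(u)=u-\ln u$ for $u\ge1$, let $h^{-1}:[1,\infty)\to[1,\infty)$ be its inverse, let $\zeta(2)=\sum_{n\ge1}n^{-2}$, and define $$\tilde h_z(x)=\begin{cases}e^{1/h^{-1}(x)}\,h^{-1}(x)&\text{if }x\ge h(1/\ln z),\\ z\,(x-\ln\ln z)&\text{otherwise,}\end{cases}\qquad \mathcal T(x)=2\,\tilde h_{3/2}\!\left(\frac{h^{-1}(1+x)+\ln(2\zeta(2))}{2}\right).$$ **Proposition 6.2.** Let $1\le R\le K$ and $\delta\in(0,1)$, and fix an identification problem of rank $R$. The extended GLR stopping rule with thresholds $$\hat c_t(\delta)=3R\ln\bigl(1+\ln(t/R)\bigr)+R\,\mathcal T\!\left(\frac{\ln\frac{M-1}{\delta}}{R}\right)$$ is $\delta$-correct: for every $\boldsymbol\mu\in\mathcal O$ and every sampling rule, $$\mathbb P_{\boldsymbol\mu}\bigl(\tau_\delta<\infty,\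 \boldsymbol\mu\notin\mathcal O_{\hat\imath(\tau_\delta)}\bigr)\le\delta,$$ and consequently $\mathbb P_{\boldsymbol\mu}(\boldsymbol\mu\in\mathcal O_{\hat\imath(\tau_\delta)})\ge1-\delta$ whenever $\tau_\delta<\infty$ almost surely. (If $M=1$, no error is possible and the value given to $\ln 0$ is irrelevant.) -/

import Mathlib

open MeasureTheory ProbabilityTheory
open scoped ENNReal

noncomputable section

namespace GLR

/-! ### The threshold function -/

/-- `h(u) = u - ln u`, used for `u ≥ 1`. -/
def h (u : ℝ) : ℝ := u - Real.log u

/-- The inverse of `h : [1,∞) → [1,∞)`. -/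
def hInv (y : ℝ) : ℝ := Function.invFunOn h (Set.Ici 1) y

/-- For `z ∈ (1,e]` this is the closed form of `min_{1 < y ≤ z} y (x - ln ln y)`. -/
def hTilde (z x : ℝ) : ℝ :=
  if h (1 / Real.log z) ≤ x then Real.exp (1 / hInv x) * hInv x
  else z * (x - Real.log (Real.log z))

/-- `ζ(2) = ∑_{n ≥ 1} n⁻²`. -/
def zetaTwo : ℝ := ∑' n : ℕ, 1 / ((n : ℝ) + 1) ^ 2

/-- The threshold function `𝒯(x) = 2 h̃_{3/2}((h⁻¹(1+x) + ln(2ζ(2)))/2)`. -/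
def calT (x : ℝ) : ℝ := 2 * hTilde (3 / 2) ((hInv (1 + x) + Real.log (2 * zetaTwo)) / 2)

/-- `ĉ_t(δ) = 3 R ln(1 + ln(t/R)) + R 𝒯(ln((M-1)/δ)/R)`. -/
def rankThreshold (R M : ℕ) (δ : ℝ) (t : ℕ) : ℝ :=
  3 * R * Real.log (1 + Real.log ((t : ℝ) / R))
    + R * calT (Real.log (((M : ℝ) - 1) / δ) / R)

/-! ### One-parameter exponential families -/

/-- A one-parameter canonical exponential family: a convex set `Θ ⊆ ℝ` of natural parameters, a
strictly convex and twice differentiable log-partition function `b` on `Θ` (one-sided derivatives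
at end points of `Θ` that belong to `Θ`; values of `b` outside `Θ` play no role) and a reference
measure `m`, such that `x ↦ exp (x θ - b θ)` is a probability density for every `θ ∈ Θ`.
Convexity of `Θ` is part of `StrictConvexOn`. -/
structure ExpFamily where
  Θ : Set ℝ
  b : ℝ → ℝ
  m : Measure ℝ
  strictConvex : StrictConvexOn ℝ Θ b
  differentiable : DifferentiableOn ℝ b Θ
  differentiable_deriv : DifferentiableOn ℝ (derivWithin b Θ) Θ
  isProbability : ∀ θ ∈ Θ,
    IsProbabilityMeasure (m.withDensity fun x => ENNReal.ofReal (Real.exp (x * θ - b θ)))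

namespace ExpFamily

/-- The distribution `ν_θ` with density `exp (x θ - b θ)` with respect to `m`. -/
def law (E : ExpFamily) (θ : ℝ) : Measure ℝ :=
  E.m.withDensity fun x => ENNReal.ofReal (Real.exp (x * θ - E.b θ))

/-- The mean of `ν_θ` (it equals `b'(θ)`). -/
def mean (E : ExpFamily) (θ : ℝ) : ℝ := ∫ x, x ∂(E.law θ)

/-- The set `ℐ` of possible means. -/
def meanSet (E : ExpFamily) : Set ℝ := E.mean '' E.Θ

/-- For `μ ∈ ℐ`, the distribution `ν^μ` of the family that has mean `μ`. -/
def arm (E : ExpFamily) (μ : ℝ) : Measure ℝ := E.law (Function.invFunOn E.mean E.Θ μ)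

/-- `d(μ, μ') = KL(ν^μ, ν^μ')`. -/
def d (E : ExpFamily) (μ μ' : ℝ) : ℝ≥0∞ := InformationTheory.klDiv (E.arm μ) (E.arm μ')

/-- `ℐ^K`. -/
def meanBox (E : ExpFamily) (K : ℕ) : Set (Fin K → ℝ) := {μ | ∀ a, μ a ∈ E.meanSet}

end ExpFamily

/-! ### Identification problems and their rank -/

/-- A sequential identification problem with `M` hypotheses: pairwise disjoint subsets
`O 0, …, O (M-1)` of `ℐ^K` that are open in `ℐ^K`. They partition their union. -/
structure IdentProblem (E : ExpFamily) (K M : ℕ) where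
  O : Fin M → Set (Fin K → ℝ)
  subset_box : ∀ i, O i ⊆ E.meanBox K
  isOpen : ∀ i, ∃ U : Set (Fin K → ℝ), IsOpen U ∧ O i = U ∩ E.meanBox K
  disjoint : ∀ i j, i ≠ j → Disjoint (O i) (O j)

namespace IdentProblem

variable {E : ExpFamily} {K M : ℕ}

/-- The set `𝒪 = ⋃ i, 𝒪_i` of possible mean vectors. -/
def total (I : IdentProblem E K M) : Set (Fin K → ℝ) := ⋃ i, I.O i

/-- `Alt(μ)`, the union of the `𝒪_i` that do not contain `μ`. -/
def alt (I : IdentProblem E K M) (μ : Fin K → ℝ) : Set (Fin K → ℝ) :=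
  ⋃ (i : Fin M) (_ : μ ∉ I.O i), I.O i

/-- The parameters in `ℐ^K` whose coordinates `k 0, …, k (R-1)` form a vector in `L`. -/
def cylinder (E : ExpFamily) {K R : ℕ} (k : Fin R → Fin K) (L : Set (Fin R → ℝ)) :
    Set (Fin K → ℝ) :=
  {v | v ∈ E.meanBox K ∧ (fun r => v (k r)) ∈ L}

/-- The problem has rank `R`: every complement `𝒪 \ 𝒪_i` is a finite union of sets that each
constrain only `R` arms, through open sets `L i q`. The union is allowed to exceed `𝒪 \ 𝒪_i` by
limit points of `𝒪 \ 𝒪_i` (parameters with ties, which `𝒪` leaves out, as in best arm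
identification); equality is a special case, see `HasRank.of_eq`. -/
def HasRank (I : IdentProblem E K M) (R : ℕ) : Prop :=
  ∃ (Q : ℕ) (k : Fin M → Fin Q → Fin R → Fin K) (L : Fin M → Fin Q → Set (Fin R → ℝ)),
    (∀ i q, IsOpen (L i q)) ∧
    ∀ i, I.total \ I.O i ⊆ (⋃ q, cylinder E (k i q) (L i q)) ∧
      (⋃ q, cylinder E (k i q) (L i q)) ⊆ closure (I.total \ I.O i)

theorem HasRank.of_eq (I : IdentProblem E K M) (R Q : ℕ)
    (k : Fin M → Fin Q → Fin R → Fin K) (L : Fin M → Fin Q → Set (Fin R → ℝ))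
    (hL : ∀ i q, IsOpen (L i q))
    (hEq : ∀ i, I.total \ I.O i = ⋃ q, cylinder E (k i q) (L i q)) : I.HasRank R :=
  ⟨Q, k, L, hL, fun i => ⟨(hEq i).subset, (hEq i).symm.subset.trans subset_closure⟩⟩

end IdentProblem

/-! ### Statistics of a trajectory

A trajectory consists of the arms `A s` and the samples `X s`, where round `s + 1` of the
interaction is indexed by `s : ℕ`; the first `t` rounds are the indices `s < t`. -/

/-- `N_a(t)`, the number of selections of arm `a` in the first `t` rounds. -/
def count {K : ℕ} (A : ℕ → Fin K) (t : ℕ) (a : Fin K) : ℕ :=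
  ((Finset.range t).filter fun s => A s = a).card

/-- The empirical mean `S_a(t) / N_a(t)`; meaningful only if `N_a(t) ≠ 0`. -/
def empMean {K : ℕ} (A : ℕ → Fin K) (X : ℕ → ℝ) (t : ℕ) (a : Fin K) : ℝ :=
  (∑ s ∈ (Finset.range t).filter fun s => A s = a, X s) / (count A t a : ℝ)

namespace IdentProblem

variable {E : ExpFamily} {K M : ℕ}

/-- The extended GLR statistic
`inf_{λ ∈ Alt(μ̂(t))} ∑_a N_a(t) d(μ̂_a(t), λ_a)`, with `inf ∅ = ∞`. -/
def glrStat (I : IdentProblem E K M) (A : ℕ → Fin K) (X : ℕ → ℝ) (t : ℕ) : ℝ≥0∞ :=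
  ⨅ v ∈ I.alt (empMean A X t), ∑ a, (count A t a : ℝ≥0∞) * E.d (empMean A X t a) (v a)

/-- The stopping condition at time `t`: `μ̂(t)` is defined (every arm has been sampled) and lies
in `𝒪`, so that there is a hypothesis to recommend, and the GLR statistic exceeds `c t`. -/
def stopsAt (I : IdentProblem E K M) (c : ℕ → ℝ) (A : ℕ → Fin K) (X : ℕ → ℝ) (t : ℕ) : Prop :=
  (∀ a, count A t a ≠ 0) ∧ empMean A X t ∈ I.total ∧
    ((c t : ℝ) : EReal) < ((I.glrStat A X t : ℝ≥0∞) : EReal)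

/-- The extended GLR stopping rule with thresholds `c`: the first time at which the stopping
condition holds, and `∞` if there is none. -/
def stoppingTime (I : IdentProblem E K M) (c : ℕ → ℝ) (A : ℕ → Fin K) (X : ℕ → ℝ) : ℕ∞ :=
  ⨅ (t : ℕ) (_ : I.stopsAt c A X t), (t : ℕ∞)

/-- `i` is the hypothesis recommended at time `t`: the (unique) index with `μ̂(t) ∈ 𝒪_i`. -/
def recommends (I : IdentProblem E K M) (A : ℕ → Fin K) (X : ℕ → ℝ) (t : ℕ) (i : Fin M) : Prop :=
  empMean A X t ∈ I.O i

/-- The rule stops and the recommended hypothesis does not contain `μ`. -/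
def errs (I : IdentProblem E K M) (c : ℕ → ℝ) (μ : Fin K → ℝ) (A : ℕ → Fin K) (X : ℕ → ℝ) :
    Prop :=
  ∃ (t : ℕ) (i : Fin M), I.stoppingTime c A X = (t : ℕ∞) ∧ I.recommends A X t i ∧ μ ∉ I.O i

/-- The rule stops and the recommended hypothesis contains `μ`. -/
def succeeds (I : IdentProblem E K M) (c : ℕ → ℝ) (μ : Fin K → ℝ) (A : ℕ → Fin K) (X : ℕ → ℝ) :
    Prop :=
  ∃ (t : ℕ) (i : Fin M), I.stoppingTime c A X = (t : ℕ∞) ∧ I.recommends A X t i ∧ μ ∈ I.O i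

end IdentProblem

/-! ### The bandit model -/

section Bandit

variable {Ω : Type*} [MeasurableSpace Ω] {K : ℕ}

/-- `ℱ_t`, generated by the arms and samples of the first `t` rounds. -/
@[reducible]
def history (A : ℕ → Ω → Fin K) (X : ℕ → Ω → ℝ) (t : ℕ) : MeasurableSpace Ω :=
  ⨆ (s : ℕ) (_ : s < t), (MeasurableSpace.comap (A s) inferInstance ⊔
    MeasurableSpace.comap (X s) inferInstance)

/-- `(A, X)` is a run, under `P`, of a bandit with mean vector `μ`: given the past and the arm
that is selected now, the next sample has law `ν^{μ_a}`, where `a` is the selected arm. How the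
arm is selected from the past, with or without extra randomisation, is not restricted, so every
sampling rule is covered. -/
structure IsBanditRun (E : ExpFamily) (μ : Fin K → ℝ) (P : Measure Ω)
    (A : ℕ → Ω → Fin K) (X : ℕ → Ω → ℝ) : Prop where
  measurable_arm : ∀ t, Measurable (A t)
  measurable_sample : ∀ t, Measurable (X t)
  cond_law : ∀ (t : ℕ) (B : Set ℝ), MeasurableSet B →
    P[(X t ⁻¹' B).indicator (fun _ => (1 : ℝ)) |
        history A X t ⊔ MeasurableSpace.comap (A t) inferInstance]
      =ᵐ[P] fun ω => (E.arm (μ (A t ω))).real B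

end Bandit

/-- The extended GLR stopping rule with thresholds `c`, recommending the hypothesis that contains
the empirical means, is `δ`-correct on the run `(A, X)` of the bandit `μ`: it stops with a wrong
recommendation with probability at most `δ`; in particular, if it stops almost surely, its
recommendation is right with probability at least `1 - δ`. -/
def IsDeltaCorrect {E : ExpFamily} {K M : ℕ} (I : IdentProblem E K M) (c : ℕ → ℝ) (δ : ℝ)
    {Ω : Type*} [MeasurableSpace Ω] (P : Measure Ω) (μ : Fin K → ℝ)
    (A : ℕ → Ω → Fin K) (X : ℕ → Ω → ℝ) : Prop :=
  P {ω | I.errs c μ (fun s => A s ω) (fun s => X s ω)} ≤ ENNReal.ofReal δ ∧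
  ((∀ᵐ ω ∂P, I.stoppingTime c (fun s => A s ω) (fun s => X s ω) ≠ ⊤) →
    ENNReal.ofReal (1 - δ) ≤ P {ω | I.succeeds c μ (fun s => A s ω) (fun s => X s ω)})

end GLR

end

namespace GLR

/-! ### The threshold function -/

/-! Suppose the rule stops and recommends a wrong index `i`. Rank `R` provides a set of `R` arms,
depending only on `i` and `μ`, such that the vector equal to `μ` on these arms and to the empirical
means elsewhere is a limit of alternatives to `i`. Since `d` is continuous in its second argument,
the GLR statistic is at most the sum of `N_a d(μ̂_a, μ_a)` over these `R` arms
(`IdentProblem.glrStat_le_sum_armDiv`). An error therefore forces a large deviation on one of at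
most `M - 1` fixed sets of arms, and each such deviation has probability at most `δ / (M - 1)`,
uniformly in time (`IsBanditRun.measure_deviation_le`).

The deviation inequality uses mixtures of likelihood ratios. For a single arm these are mixed over
the two sides of the true parameter, over geometric slices of the sample count, and over an
exponentially distributed level. This gives a supermartingale that is at least `(1 - lam) * exp (lam
* Y)`, where `Y` is the divergence after an iterated-logarithm correction and an affine rescaling
(`ExpFamily.exists_isTestFun`). One round changes the data of one arm only, so products over arms
remain supermartingales under every sampling rule, and Ville's inequality applies.

The shape of the threshold comes from tuning: the best `lam` produces `h⁻¹`, the best slice ratio `η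
≤ 3/2` produces `h̃_{3/2}`, and Jensen's inequality merges the `R` iterated logarithms into `R ln(1
+ ln(t/R))`. -/

theorem strictMonoOn_h : StrictMonoOn h (Set.Ici 1) := by
  intro u hu v hv huv
  have hu0 : (0 : ℝ) < u := lt_of_lt_of_le one_pos hu
  have hlog : Real.log (v / u) < v / u - 1 :=
    Real.log_lt_sub_one_of_pos (div_pos (hu0.trans huv) hu0) ((one_lt_div hu0).2 huv).ne'
  rw [Real.log_div (hu0.trans huv).ne' hu0.ne'] at hlog
  have hle : v / u - 1 ≤ v - u := by
    rw [div_sub_one hu0.ne', div_le_iff₀ hu0]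
    have : (1 : ℝ) ≤ u := hu
    nlinarith
  unfold h
  linarith

theorem exists_h_eq {y : ℝ} (hy : 1 ≤ y) : ∃ u ∈ Set.Ici (1 : ℝ), h u = y := by
  have hcont : ContinuousOn h (Set.Icc 1 (2 * y)) := by
    unfold h
    exact continuousOn_id.sub
      (Real.continuousOn_log.mono fun x hx => (one_pos.trans_le hx.1).ne')
  have h1 : h 1 ≤ y := by simpa [h] using hy
  have h2 : y ≤ h (2 * y) := by
    have : Real.log y ≤ y - 1 := Real.log_le_sub_one_of_pos (by linarith)
    have hl2 : Real.log 2 ≤ 2 - 1 := Real.log_le_sub_one_of_pos (by norm_num)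
    unfold h
    rw [Real.log_mul (by norm_num) (by linarith)]
    linarith
  obtain ⟨u, hu, huy⟩ := intermediate_value_Icc (by linarith) hcont ⟨h1, h2⟩
  exact ⟨u, hu.1, huy⟩

theorem hInv_mem {y : ℝ} (hy : 1 ≤ y) : 1 ≤ hInv y :=
  Function.invFunOn_mem (exists_h_eq hy)

theorem h_hInv {y : ℝ} (hy : 1 ≤ y) : h (hInv y) = y :=
  Function.invFunOn_eq (exists_h_eq hy)

theorem log_three_halves_lt_one : Real.log (3 / 2) < 1 := by
  have := Real.log_le_sub_one_of_pos (show (0 : ℝ) < 3 / 2 by norm_num)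
  linarith

/-- The minimum over `η ∈ (1, z]` that `hTilde z` expresses in closed form is attained. -/
theorem exists_hTilde_eq {z : ℝ} (hz1 : 1 < z) (hz : Real.log z ≤ 1) (w : ℝ) :
    ∃ η, 1 < η ∧ η ≤ z ∧ hTilde z w = η * (w - Real.log (Real.log η)) := by
  unfold hTilde
  split_ifs with hw
  · have hlz : 0 < Real.log z := Real.log_pos hz1
    have h1z : (1 : ℝ) ≤ 1 / Real.log z := (one_le_div hlz).2 hz
    have hw1 : 1 ≤ w := by
      have : h 1 ≤ h (1 / Real.log z) := strictMonoOn_h.monotoneOn (Set.mem_Ici.2 le_rfl) h1z h1z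
      simp only [h, Real.log_one, sub_zero] at this
      exact this.trans hw
    have hu := hInv_mem hw1
    have huw := h_hInv hw1
    have hzu : 1 / Real.log z ≤ hInv w := by
      rw [← huw] at hw
      exact (strictMonoOn_h.le_iff_le h1z hu).1 hw
    have hu0 : 0 < hInv w := by linarith
    -- The critical point of `η ↦ η (w - ln ln η)`: with `u = 1 / ln η` the derivative vanishes when
    -- `u - ln u = w`.
    refine ⟨Real.exp (1 / hInv w), Real.one_lt_exp_iff.2 (by positivity), ?_, ?_⟩
    · rw [← Real.le_log_iff_exp_le (by linarith)]
      rwa [one_div_le hu0 hlz]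
    · have hl : Real.log (1 / hInv w) = -Real.log (hInv w) := by rw [one_div, Real.log_inv]
      rw [Real.log_exp, hl]
      have : w = hInv w - Real.log (hInv w) := huw.symm
      rw [sub_neg_eq_add]
      congr 1
      linarith
  · exact ⟨z, hz1, le_rfl, rfl⟩

theorem hasSum_zetaTwo : HasSum (fun n : ℕ => 1 / ((n : ℝ) + 1) ^ 2) zetaTwo := by
  have := (summable_nat_add_iff (f := fun n : ℕ => 1 / (n : ℝ) ^ 2) 1).2
    (Real.summable_one_div_nat_pow.2 one_lt_two)
  simpa [zetaTwo] using this.hasSum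

theorem one_le_zetaTwo : 1 ≤ zetaTwo := by
  have := hasSum_zetaTwo.summable.le_tsum 0 (fun n _ => by positivity)
  simpa [zetaTwo] using this

theorem log_two_zetaTwo_pos : 0 < Real.log (2 * zetaTwo) :=
  Real.log_pos (by linarith [one_le_zetaTwo])

/-- Unpacks `calT` into the two tuning parameters of the mixture: `η` is the slice ratio, and `C`
fixes the exponent `1 - 1 / C`. Strict positivity of `x` makes `C > 1`, so that this exponent lies
in `(0, 1)`. -/
theorem exists_calT_eq {x : ℝ} (hx : 0 < x) :
    ∃ C η : ℝ, 1 < C ∧ C - Real.log C = 1 + x ∧ 1 < η ∧ η ≤ 3 / 2 ∧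
      calT x = η * (C + Real.log (2 * zetaTwo) - 2 * Real.log (Real.log η)) := by
  have hx1 : 1 ≤ 1 + x := by linarith
  obtain ⟨η, h1, h2, h3⟩ := exists_hTilde_eq (z := 3 / 2) (by norm_num)
    log_three_halves_lt_one.le ((hInv (1 + x) + Real.log (2 * zetaTwo)) / 2)
  refine ⟨hInv (1 + x), η, lt_of_le_of_ne (hInv_mem hx1) fun hC => ?_, h_hInv hx1, h1, h2, ?_⟩
  · have := h_hInv hx1
    rw [← hC] at this
    simp only [h, Real.log_one] at this
    linarith
  · unfold calT
    rw [h3]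
    ring

/-- Jensen's inequality for `u ↦ ln (1 + ln u)`. -/
theorem sum_log_one_add_log_le {ι : Type*} (s : Finset ι) (hs : s.Nonempty) (n : ι → ℝ) (t : ℝ)
    (hn : ∀ i ∈ s, 1 ≤ n i) (ht : ∑ i ∈ s, n i ≤ t) :
    ∑ i ∈ s, Real.log (1 + Real.log (n i))
      ≤ s.card * Real.log (1 + Real.log (t / s.card)) := by
  have hc : (0 : ℝ) < s.card := by exact_mod_cast hs.card_pos
  have hw : ∑ _i ∈ s, (1 / (s.card : ℝ)) = 1 := by
    rw [Finset.sum_const, nsmul_eq_mul]; field_simp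
  have hlog : ∀ i ∈ s, 0 ≤ Real.log (n i) := fun i hi => Real.log_nonneg (hn i hi)
  have jensen : ∀ g : ι → ℝ, (∀ i ∈ s, 0 < g i) →
      ∑ i ∈ s, Real.log (g i) ≤ s.card * Real.log ((∑ i ∈ s, g i) / s.card) := by
    intro g hg
    have := strictConcaveOn_log_Ioi.concaveOn.le_map_sum (t := s)
      (w := fun _ => 1 / (s.card : ℝ)) (p := g) (fun _ _ => by positivity) hw hg
    simp only [smul_eq_mul, ← Finset.mul_sum] at this
    rw [one_div, inv_mul_eq_div, inv_mul_eq_div, div_le_iff₀ hc] at this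
    linarith
  have hsum : (s.card : ℝ) ≤ ∑ i ∈ s, n i := by
    have := Finset.card_nsmul_le_sum s n 1 hn
    simpa using this
  have hlogsum : (∑ i ∈ s, (1 + Real.log (n i))) / s.card ≤ 1 + Real.log (t / s.card) := by
    rw [Finset.sum_add_distrib, div_le_iff₀ hc]
    have h1 := jensen n fun i hi => one_pos.trans_le (hn i hi)
    have h2 : Real.log ((∑ i ∈ s, n i) / s.card) ≤ Real.log (t / s.card) :=
      Real.log_le_log (div_pos (hc.trans_le hsum) hc) (by gcongr)
    have h3 := mul_le_mul_of_nonneg_left h2 hc.le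
    simp only [Finset.sum_const, nsmul_eq_mul, mul_one]
    linarith
  refine (jensen (fun i => 1 + Real.log (n i)) fun i hi => by linarith [hlog i hi]).trans ?_
  refine mul_le_mul_of_nonneg_left (Real.log_le_log ?_ hlogsum) hc.le
  exact div_pos (Finset.sum_pos (fun i hi => by linarith [hlog i hi]) hs) hc

/-! ### Means of exponential families -/

/-- Chord slopes of a convex function increase. This makes the difference quotients of the moment
generating function monotone, pointwise in `x`. -/
theorem exp_sub_one_div_le {h h' x : ℝ} (h0 : 0 < h) (hh : h ≤ h') :
    (Real.exp (h * x) - 1) / h ≤ (Real.exp (h' * x) - 1) / h' := by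
  have h0' : 0 < h' := h0.trans_le hh
  have hc := convexOn_exp.2 (Set.mem_univ (h' * x)) (Set.mem_univ 0)
    (show 0 ≤ h / h' by positivity) (show 0 ≤ 1 - h / h' from sub_nonneg.2 ((div_le_one h0').2 hh))
    (by ring)
  simp only [smul_eq_mul, mul_zero, add_zero, Real.exp_zero, mul_one] at hc
  rw [show h / h' * (h' * x) = h * x by field_simp] at hc
  rw [div_le_iff₀ h0]
  calc Real.exp (h * x) - 1 ≤ h / h' * Real.exp (h' * x) + (1 - h / h') - 1 := by linarith
    _ = (Real.exp (h' * x) - 1) / h' * h := by ring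

theorem tendsto_slope_seq {f : ℝ → ℝ} {f' h₀ : ℝ} (h₀pos : 0 < h₀)
    (hf : HasDerivWithinAt f f' (Set.Icc 0 h₀) 0) :
    Filter.Tendsto (fun n : ℕ => (f (h₀ / (n + 1)) - f 0) / (h₀ / (n + 1))) Filter.atTop
      (nhds f') := by
  rw [hasDerivWithinAt_iff_tendsto_slope] at hf
  have hseq : Filter.Tendsto (fun n : ℕ => h₀ / ((n : ℝ) + 1)) Filter.atTop
      (nhdsWithin 0 (Set.Icc 0 h₀ \ {0})) := by
    refine tendsto_nhdsWithin_iff.2 ⟨?_, Filter.Eventually.of_forall fun n => ?_⟩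
    · have := (tendsto_one_div_add_atTop_nhds_zero_nat (𝕜 := ℝ)).const_mul h₀
      simpa [div_eq_mul_inv] using this
    · refine ⟨⟨by positivity, ?_⟩, ?_⟩
      · exact div_le_self h₀pos.le (by linarith [(Nat.cast_nonneg n : (0 : ℝ) ≤ n)])
      · exact (by positivity : (0 : ℝ) < h₀ / ((n : ℝ) + 1)).ne'
  refine (hf.comp hseq).congr fun n => ?_
  simp [slope_def_field]

/-- If the moment generating function is finite on `[0, h₀]` and has a right derivative at `0`,
then the mean exists and equals that derivative. -/
theorem integrable_id_of_hasDerivWithinAt_mgf (ν : Measure ℝ) [IsProbabilityMeasure ν]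
    {h₀ M' : ℝ} (h₀pos : 0 < h₀)
    (hint : ∀ h ∈ Set.Icc 0 h₀, Integrable (fun x => Real.exp (h * x)) ν)
    (hd : HasDerivWithinAt (fun h => ∫ x, Real.exp (h * x) ∂ν) M' (Set.Icc 0 h₀) 0) :
    Integrable (fun x : ℝ => x) ν ∧ ∫ x, x ∂ν = M' := by
  set s : ℕ → ℝ := fun n => h₀ / (n + 1) with hs
  have spos : ∀ n, 0 < s n := fun n => by positivity
  have sle : ∀ n, s n ≤ h₀ := fun n =>
    div_le_self h₀pos.le (by linarith [(Nat.cast_nonneg n : (0 : ℝ) ≤ n)])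
  have santi : Antitone s := fun m n hmn => by
    simp only [hs]; gcongr
  set F : ℕ → ℝ → ℝ := fun n x => (Real.exp (s n * x) - 1) / s n with hF
  have Fint : ∀ n, Integrable (F n) ν := fun n =>
    ((hint (s n) ⟨(spos n).le, sle n⟩).sub (integrable_const 1)).div_const _
  have Fanti : ∀ x, Antitone fun n => F n x := fun x m n hmn =>
    exp_sub_one_div_le (spos n) (santi hmn)
  have Flim : ∀ x, Filter.Tendsto (fun n => F n x) Filter.atTop (nhds x) := by
    intro x
    have : HasDerivAt (fun h : ℝ => Real.exp (h * x)) x 0 := by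
      have := ((hasDerivAt_id (0 : ℝ)).mul_const x).exp
      simpa using this
    have := tendsto_slope_seq h₀pos (this.hasDerivWithinAt (s := Set.Icc 0 h₀))
    simpa [hF, hs] using this
  have Ilim : Filter.Tendsto (fun n => ∫ x, F n x ∂ν) Filter.atTop (nhds M') := by
    refine (tendsto_slope_seq h₀pos hd).congr fun n => ?_
    rw [hF]
    simp only
    rw [integral_div, integral_sub (hint (s n) ⟨(spos n).le, sle n⟩) (integrable_const 1)]
    simp [hs]
  have hid : Integrable (fun x : ℝ => x) ν := by
    refine integrable_of_tendsto (G := F) (Filter.Eventually.of_forall Flim)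
      (fun n => (Fint n).aestronglyMeasurable) ?_
    -- Fatou: `F n ≤ F 0` pointwise and the integrals of `F n` converge, hence are bounded below, so
    -- the `L¹` norms of `F n` are bounded.
    obtain ⟨B, hB⟩ := Ilim.bddBelow_range
    have hle : ∀ n, ∫⁻ x, ‖F n x‖ₑ ∂ν
        ≤ ENNReal.ofReal (∫ x, F 0 x ∂ν - B + ∫ x, ‖F 0 x‖ ∂ν) := by
      intro n
      rw [← ofReal_integral_norm_eq_lintegral_enorm (Fint n)]
      refine ENNReal.ofReal_le_ofReal ?_
      have h1 : ∫ x, ‖F n x‖ ∂ν ≤ ∫ x, (F 0 x - F n x + ‖F 0 x‖) ∂ν := by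
        refine integral_mono (Fint n).norm (((Fint 0).sub (Fint n)).add (Fint 0).norm) fun x => ?_
        have := Fanti x (Nat.zero_le n)
        simp only [Real.norm_eq_abs] at this ⊢
        rw [abs_le]
        constructor <;> linarith [neg_abs_le (F 0 x), le_abs_self (F 0 x)]
      have h2 : ∫ x, (F 0 x - F n x + ‖F 0 x‖) ∂ν
          = ∫ x, F 0 x ∂ν - ∫ x, F n x ∂ν + ∫ x, ‖F 0 x‖ ∂ν := by
        rw [← integral_sub (Fint 0) (Fint n)]
        exact integral_add ((Fint 0).sub (Fint n)) (Fint 0).norm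
      have : B ≤ ∫ x, F n x ∂ν := hB (Set.mem_range_self n)
      linarith
    refine ne_top_of_le_ne_top ENNReal.ofReal_ne_top
      ((Filter.liminf_le_liminf (Filter.Eventually.of_forall hle)).trans
        (Filter.liminf_const _).le)
  refine ⟨hid, tendsto_nhds_unique ?_ Ilim⟩
  exact integral_tendsto_of_tendsto_of_antitone Fint hid (Filter.Eventually.of_forall Fanti)
    (Filter.Eventually.of_forall Flim)

/-! ### Change of measure, means as derivatives of `b`, and KL as a Bregman divergence -/

namespace ExpFamily

variable (E : ExpFamily) {θ θ' : ℝ}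

theorem isProbabilityMeasure_law (hθ : θ ∈ E.Θ) : IsProbabilityMeasure (E.law θ) :=
  E.isProbability θ hθ

theorem law_eq_withDensity (θ θ' : ℝ) : E.law θ' = (E.law θ).withDensity
    fun x => ENNReal.ofReal (Real.exp ((θ' - θ) * x - (E.b θ' - E.b θ))) := by
  unfold law
  rw [← withDensity_mul _ (by fun_prop) (by fun_prop)]
  congr 1
  ext x
  simp only [Pi.mul_apply]
  rw [← ENNReal.ofReal_mul (Real.exp_pos _).le, ← Real.exp_add]
  congr 2
  ring

theorem lintegral_likelihood (θ : ℝ) (hθ' : θ' ∈ E.Θ) :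
    ∫⁻ x, ENNReal.ofReal (Real.exp ((θ' - θ) * x - (E.b θ' - E.b θ))) ∂(E.law θ) = 1 := by
  have := (E.isProbabilityMeasure_law hθ').measure_univ
  rwa [E.law_eq_withDensity θ θ', withDensity_apply _ MeasurableSet.univ,
    setLIntegral_univ] at this

theorem lintegral_exp (θ : ℝ) (hθ' : θ' ∈ E.Θ) :
    ∫⁻ x, ENNReal.ofReal (Real.exp ((θ' - θ) * x)) ∂(E.law θ)
      = ENNReal.ofReal (Real.exp (E.b θ' - E.b θ)) := by
  have h1 : ∀ x, ENNReal.ofReal (Real.exp ((θ' - θ) * x))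
      = ENNReal.ofReal (Real.exp (E.b θ' - E.b θ))
        * ENNReal.ofReal (Real.exp ((θ' - θ) * x - (E.b θ' - E.b θ))) := by
    intro x
    rw [← ENNReal.ofReal_mul (Real.exp_pos _).le, ← Real.exp_add]
    congr 2
    ring
  simp_rw [h1]
  rw [lintegral_const_mul _ (by fun_prop), E.lintegral_likelihood θ hθ', mul_one]

theorem integrable_exp (θ : ℝ) (hθ' : θ' ∈ E.Θ) :
    Integrable (fun x => Real.exp ((θ' - θ) * x)) (E.law θ) := by
  refine ⟨by fun_prop, ?_⟩
  rw [hasFiniteIntegral_iff_ofReal (Filter.Eventually.of_forall fun x => (Real.exp_pos _).le),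
    E.lintegral_exp θ hθ']
  exact ENNReal.ofReal_lt_top

theorem integral_exp (θ : ℝ) (hθ' : θ' ∈ E.Θ) :
    ∫ x, Real.exp ((θ' - θ) * x) ∂(E.law θ) = Real.exp (E.b θ' - E.b θ) := by
  rw [integral_eq_lintegral_of_nonneg_ae
    (Filter.Eventually.of_forall fun x => (Real.exp_pos _).le) (by fun_prop),
    E.lintegral_exp θ hθ', ENNReal.toReal_ofReal (Real.exp_pos _).le]

theorem ordConnected : E.Θ.OrdConnected := E.strictConvex.1.ordConnected

theorem hasDerivWithinAt_b (hθ : θ ∈ E.Θ) :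
    HasDerivWithinAt E.b (derivWithin E.b E.Θ θ) E.Θ θ :=
  (E.differentiable θ hθ).hasDerivWithinAt

/-- The moment generating function of `ν_θ` at `h` is `exp (b (θ + h) - b θ)`, whose derivative at
`0` is `b' θ`. At an end point of `Θ` only one side is available, so a one-sided derivative is used.
If `Θ` were a single point, `derivWithin` would be the default value `0` and carry no information.
-/
theorem integrable_id_and_mean_eq (hΘ : E.Θ.Nontrivial) (hθ : θ ∈ E.Θ) :
    Integrable (fun x : ℝ => x) (E.law θ) ∧ E.mean θ = derivWithin E.b E.Θ θ := by
  have := E.isProbabilityMeasure_law hθ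
  obtain ⟨θ', hθ', hne⟩ := hΘ.exists_ne θ
  have key : ∀ σ h₀ : ℝ, 0 < h₀ → (∀ h ∈ Set.Icc 0 h₀, θ + σ * h ∈ E.Θ) →
      (∀ h ∈ Set.Icc 0 h₀, Integrable (fun x => Real.exp (h * (σ * x))) (E.law θ)) ∧
      HasDerivWithinAt (fun h => ∫ x, Real.exp (h * (σ * x)) ∂(E.law θ))
        (derivWithin E.b E.Θ θ * σ) (Set.Icc 0 h₀) 0 := by
    intro σ h₀ _ hmem
    have e : ∀ h x : ℝ, h * (σ * x) = ((θ + σ * h) - θ) * x := fun h x => by ring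
    refine ⟨fun h hh => ?_, ?_⟩
    · simp_rw [e]
      exact E.integrable_exp θ (hmem h hh)
    · have h1 : HasDerivWithinAt (fun h => θ + σ * h) σ (Set.Icc 0 h₀) 0 := by
        have := ((hasDerivAt_id (0 : ℝ)).const_mul σ).const_add θ
        simpa using this.hasDerivWithinAt
      have h2 : HasDerivWithinAt E.b (derivWithin E.b E.Θ θ) E.Θ (θ + σ * 0) := by
        simpa using E.hasDerivWithinAt_b hθ
      have h3 := ((h2.comp (0 : ℝ) h1 hmem).sub_const (E.b θ)).exp
      simp only [Function.comp_apply, mul_zero, add_zero, sub_self, Real.exp_zero, one_mul] at h3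
      refine h3.congr_of_mem (fun h hh => ?_) ⟨le_rfl, by linarith⟩
      simp_rw [e]
      exact E.integral_exp θ (hmem h hh)
  rcases lt_or_gt_of_ne hne with hlt | hlt
  · obtain ⟨k1, k2⟩ := key (-1) (θ - θ') (by linarith) fun h hh =>
      E.ordConnected.out hθ' hθ ⟨by linarith [hh.2], by linarith [hh.1]⟩
    -- When `Θ` is only known to extend to the left of `θ`, the right-sided criterion is applied to
    -- the reflected law.
    have hm : MeasurableEmbedding (fun x : ℝ => -1 * x) := by
      simpa using (MeasurableEquiv.neg ℝ).measurableEmbedding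
    have : IsProbabilityMeasure ((E.law θ).map fun x => -1 * x) :=
      Measure.isProbabilityMeasure_map (by fun_prop)
    obtain ⟨i1, i2⟩ := integrable_id_of_hasDerivWithinAt_mgf
      ((E.law θ).map fun x => -1 * x) (h₀ := θ - θ')
      (M' := derivWithin E.b E.Θ θ * -1) (by linarith)
      (fun h hh => by
        rw [hm.integrable_map_iff]
        exact k1 h hh)
      (by simpa only [hm.integral_map] using k2)
    rw [hm.integrable_map_iff] at i1
    rw [hm.integral_map, integral_const_mul] at i2
    refine ⟨?_, ?_⟩
    · simpa [Function.comp_def, Pi.neg_def] using i1.neg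
    · unfold mean
      linarith
  · obtain ⟨k1, k2⟩ := key 1 (θ' - θ) (by linarith) fun h hh =>
      E.ordConnected.out hθ hθ' ⟨by linarith [hh.1], by linarith [hh.2]⟩
    simp only [one_mul, mul_one] at k1 k2
    exact integrable_id_of_hasDerivWithinAt_mgf (E.law θ) (by linarith) k1 k2

theorem strictMonoOn_mean (hΘ : E.Θ.Nontrivial) : StrictMonoOn E.mean E.Θ :=
  (E.strictConvex.strictMonoOn_derivWithin E.differentiable).congr
    fun _ hθ => (E.integrable_id_and_mean_eq hΘ hθ).2.symm

theorem continuousOn_mean (hΘ : E.Θ.Nontrivial) : ContinuousOn E.mean E.Θ :=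
  E.differentiable_deriv.continuousOn.congr
    fun _ hθ => (E.integrable_id_and_mean_eq hΘ hθ).2

theorem continuousOn_b : ContinuousOn E.b E.Θ := E.differentiable.continuousOn

theorem tangent_lt (hΘ : E.Θ.Nontrivial) (hθ : θ ∈ E.Θ) (hθ' : θ' ∈ E.Θ) (hne : θ ≠ θ') :
    E.b θ + E.mean θ * (θ' - θ) < E.b θ' := by
  rw [(E.integrable_id_and_mean_eq hΘ hθ).2]
  rcases lt_or_gt_of_ne hne with hlt | hlt
  · have := E.strictConvex.derivWithin_lt_slope hθ hθ' hlt (E.differentiable θ hθ)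
    rw [slope_def_field, lt_div_iff₀ (by linarith)] at this
    linarith
  · have := E.strictConvex.slope_lt_derivWithin hθ' hθ hlt (E.differentiable θ hθ)
    rw [slope_def_field, div_lt_iff₀ (by linarith)] at this
    linarith

/-- `KL(ν_θ, ν_θ')` as a Bregman divergence of `b`. -/
noncomputable def bregman (θ θ' : ℝ) : ℝ := E.b θ' - E.b θ - E.mean θ * (θ' - θ)

theorem bregman_nonneg (hΘ : E.Θ.Nontrivial) (hθ : θ ∈ E.Θ) (hθ' : θ' ∈ E.Θ) :
    0 ≤ E.bregman θ θ' := by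
  unfold bregman
  rcases eq_or_ne θ θ' with rfl | hne
  · simp
  · linarith [E.tangent_lt hΘ hθ hθ' hne]

/-- The log-likelihood ratio is affine in the sample, so its expectation under `ν_θ` involves only
the mean. -/
theorem klDiv_law (hΘ : E.Θ.Nontrivial) (hθ : θ ∈ E.Θ) (hθ' : θ' ∈ E.Θ) :
    InformationTheory.klDiv (E.law θ) (E.law θ') = ENNReal.ofReal (E.bregman θ θ') := by
  have := E.isProbabilityMeasure_law hθ
  have := E.isProbabilityMeasure_law hθ'
  have hac : E.law θ ≪ E.law θ' := by
    rw [E.law_eq_withDensity θ' θ]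
    exact withDensity_absolutelyContinuous _ _
  have hllr : llr (E.law θ) (E.law θ')
      =ᵐ[E.law θ] fun x => (θ - θ') * x - (E.b θ - E.b θ') := by
    have h1 : (E.law θ).rnDeriv (E.law θ') =ᵐ[E.law θ']
        fun x => ENNReal.ofReal (Real.exp ((θ - θ') * x - (E.b θ - E.b θ'))) := by
      conv_lhs => rw [E.law_eq_withDensity θ' θ]
      exact Measure.rnDeriv_withDensity _ (by fun_prop)
    filter_upwards [hac.ae_le h1] with x hx
    rw [llr, hx, ENNReal.toReal_ofReal (Real.exp_pos _).le, Real.log_exp]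
  obtain ⟨hi, hm⟩ := E.integrable_id_and_mean_eq hΘ hθ
  have hi2 : Integrable (fun x => (θ - θ') * x - (E.b θ - E.b θ')) (E.law θ) :=
    (hi.const_mul _).sub (integrable_const _)
  rw [InformationTheory.klDiv_of_ac_of_integrable hac (hi2.congr hllr.symm),
    integral_congr_ae hllr, integral_sub (hi.const_mul _) (integrable_const _),
    integral_const_mul]
  simp only [integral_const, probReal_univ, one_smul, add_sub_cancel_right]
  congr 1
  unfold bregman mean
  ring

/-- The natural parameter of the member of the family with mean `μ`. -/
noncomputable def param (μ : ℝ) : ℝ := Function.invFunOn E.mean E.Θ μ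

variable {μ μ' : ℝ}

theorem param_mem (hμ : μ ∈ E.meanSet) : E.param μ ∈ E.Θ := Function.invFunOn_mem hμ

theorem mean_param (hμ : μ ∈ E.meanSet) : E.mean (E.param μ) = μ := Function.invFunOn_eq hμ

theorem d_eq (hΘ : E.Θ.Nontrivial) (hμ : μ ∈ E.meanSet) (hμ' : μ' ∈ E.meanSet) :
    E.d μ μ' = ENNReal.ofReal (E.bregman (E.param μ) (E.param μ')) :=
  E.klDiv_law hΘ (E.param_mem hμ) (E.param_mem hμ')

theorem d_self (hΘ : E.Θ.Nontrivial) (hμ : μ ∈ E.meanSet) : E.d μ μ = 0 := by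
  rw [E.d_eq hΘ hμ hμ]
  simp [bregman]

/-- The mean map is an order isomorphism between two intervals, and order isomorphisms are
homeomorphisms for the order topologies. -/
theorem continuousOn_param (hΘ : E.Θ.Nontrivial) : ContinuousOn E.param E.meanSet := by
  have := E.ordConnected
  have : (E.mean '' E.Θ).OrdConnected :=
    (E.ordConnected.isPreconnected.image _ (E.continuousOn_mean hΘ)).ordConnected
  have hmono := E.strictMonoOn_mean hΘ
  have hc : Continuous fun y : E.mean '' E.Θ => ((hmono.orderIso E.mean E.Θ).symm y : ℝ) :=
    continuous_subtype_val.comp (hmono.orderIso E.mean E.Θ).symm.continuous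
  refine continuousOn_iff_continuous_domRestrict.2 (hc.congr fun y => ?_)
  apply hmono.injOn (Subtype.coe_prop _) (E.param_mem y.2)
  refine Eq.trans ?_ (E.mean_param y.2).symm
  exact congrArg Subtype.val ((hmono.orderIso E.mean E.Θ).apply_symm_apply y)

theorem continuousOn_d (hΘ : E.Θ.Nontrivial) (hμ : μ ∈ E.meanSet) :
    ContinuousOn (E.d μ) E.meanSet := by
  have hp := E.continuousOn_param hΘ
  have hb : ContinuousOn (fun μ' => E.b (E.param μ')) E.meanSet :=
    E.continuousOn_b.comp hp fun _ h => E.param_mem h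
  refine ContinuousOn.congr (f := fun μ' => ENNReal.ofReal (E.bregman (E.param μ) (E.param μ')))
    ?_ fun μ' hμ' => E.d_eq hΘ hμ hμ'
  refine ENNReal.continuous_ofReal.comp_continuousOn ?_
  unfold bregman
  fun_prop

end ExpFamily

/-! ### Selecting the parameter at a prescribed divergence -/

/-- For `z ≥ θ` the divergence `D z` of `z` from `θ` increases strictly from `0`, and `g` is its
inverse. With empirical mean `b' (g c)` the log-likelihood ratio of `g c` against `θ` is exactly `c`
per sample. It increases with the empirical mean because `g c ≥ θ`, so the single parameter `g c`
detects every `y ≥ θ` with `D y ≥ c`. -/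
theorem exists_measurable_level_selector {Θ : Set ℝ} {b b' : ℝ → ℝ} (hΘ : Θ.OrdConnected)
    (hb : ContinuousOn b Θ) (hb' : ContinuousOn b' Θ)
    (ht : ∀ x ∈ Θ, ∀ y ∈ Θ, x ≠ y → b x + b' x * (y - x) < b y) {θ : ℝ} (hθ : θ ∈ Θ) :
    ∃ g : ℝ → ℝ, Measurable g ∧ (∀ c, g c ∈ Θ) ∧ ∀ y ∈ Θ, θ ≤ y → ∀ c, 0 ≤ c →
      c ≤ b θ - b y - b' y * (θ - y) → c ≤ (g c - θ) * b' y - (b (g c) - b θ) := by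
  classical
  set D : ℝ → ℝ := fun z => b θ - b z - b' z * (θ - z) with hD
  have mono' : ∀ x ∈ Θ, ∀ y ∈ Θ, x < y → b' x < b' y := by
    intro x hx y hy hxy
    have h1 := ht x hx y hy hxy.ne
    have h2 := ht y hy x hx hxy.ne'
    nlinarith
  have hT : (Θ ∩ Set.Ici θ).OrdConnected := hΘ.inter Set.ordConnected_Ici
  have Dmono : StrictMonoOn D (Θ ∩ Set.Ici θ) := by
    rintro x ⟨hx, hxθ⟩ y ⟨hy, _⟩ hxy
    have h1 := ht y hy x hx hxy.ne'
    have h2 := mono' x hx y hy hxy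
    have h3 : 0 ≤ x - θ := sub_nonneg.2 hxθ
    simp only [hD]
    nlinarith [mul_nonneg (sub_nonneg.2 h2.le) h3]
  have Dcont : ContinuousOn D Θ := by
    simp only [hD]
    fun_prop
  set C : Set ℝ := D '' (Θ ∩ Set.Ici θ) with hC
  have hCord : C.OrdConnected :=
    (hT.isPreconnected.image _ (Dcont.mono Set.inter_subset_left)).ordConnected
  set g : ℝ → ℝ := fun c => if hc : c ∈ C then hc.choose else θ with hg
  have gspec : ∀ c ∈ C, g c ∈ Θ ∩ Set.Ici θ ∧ D (g c) = c := by
    intro c hc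
    simp only [hg, dif_pos hc]
    exact hc.choose_spec
  refine ⟨g, ?_, fun c => ?_, fun y hy hθy c hc0 hcD => ?_⟩
  -- `g` is monotone on the interval `C` of attained levels and constant off it.
  · refine measurable_of_restrict_of_restrict_compl hCord.measurableSet ?_ ?_
    · refine Monotone.measurable fun c₁ c₂ hcc => ?_
      have h1 := gspec c₁ c₁.2
      have h2 := gspec c₂ c₂.2
      refine (Dmono.le_iff_le h1.1 h2.1).1 ?_
      rw [h1.2, h2.2]
      exact hcc
    · have : Cᶜ.domRestrict g = fun _ => θ := by
        ext c
        simp only [Set.domRestrict_apply, hg]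
        exact dif_neg c.2
      rw [this]
      exact measurable_const
  · by_cases hc : c ∈ C
    · exact (gspec c hc).1.1
    · simpa only [hg, dif_neg hc] using hθ
  · have hcC : c ∈ C := by
      have hsub : Set.Icc θ y ⊆ Θ := hΘ.out hθ hy
      have hc : c ∈ Set.Icc (D θ) (D y) := ⟨by simpa [hD] using hc0, hcD⟩
      obtain ⟨z, hz, hzc⟩ := intermediate_value_Icc hθy (Dcont.mono hsub) hc
      exact ⟨z, ⟨hsub hz, hz.1⟩, hzc⟩
    obtain ⟨⟨hgΘ, hgθ⟩, hgc⟩ := gspec c hcC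
    have hgy : g c ≤ y := (Dmono.le_iff_le ⟨hgΘ, hgθ⟩ ⟨hy, hθy⟩).1 (by rw [hgc]; exact hcD)
    have hm : b' (g c) ≤ b' y := by
      rcases hgy.lt_or_eq with hlt | heq
      · exact (mono' _ hgΘ _ hy hlt).le
      · rw [heq]
    have h3 : 0 ≤ g c - θ := sub_nonneg.2 hgθ
    simp only [hD] at hgc
    nlinarith [mul_nonneg (sub_nonneg.2 hm) h3]

namespace ExpFamily

variable (E : ExpFamily) {θ : ℝ}

theorem exists_selector_above (hΘ : E.Θ.Nontrivial) (hθ : θ ∈ E.Θ) :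
    ∃ g : ℝ → ℝ, Measurable g ∧ (∀ c, g c ∈ E.Θ) ∧ ∀ y ∈ E.Θ, θ ≤ y → ∀ c, 0 ≤ c →
      c ≤ E.bregman y θ → c ≤ (g c - θ) * E.mean y - (E.b (g c) - E.b θ) :=
  exists_measurable_level_selector E.ordConnected E.continuousOn_b (E.continuousOn_mean hΘ)
    (fun _ hx _ hy hne => E.tangent_lt hΘ hx hy hne) hθ

/-- The reflection `x ↦ -x` of the parameter reduces this to parameters above `-θ`. -/
theorem exists_selector_below (hΘ : E.Θ.Nontrivial) (hθ : θ ∈ E.Θ) :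
    ∃ g : ℝ → ℝ, Measurable g ∧ (∀ c, g c ∈ E.Θ) ∧ ∀ y ∈ E.Θ, y ≤ θ → ∀ c, 0 ≤ c →
      c ≤ E.bregman y θ → c ≤ (g c - θ) * E.mean y - (E.b (g c) - E.b θ) := by
  have hord : (Neg.neg ⁻¹' E.Θ).OrdConnected :=
    ⟨fun x hx y hy z hz => E.ordConnected.out hy hx ⟨neg_le_neg hz.2, neg_le_neg hz.1⟩⟩
  obtain ⟨g, hg, hgΘ, hgc⟩ := exists_measurable_level_selector (Θ := Neg.neg ⁻¹' E.Θ)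
    (b := fun x => E.b (-x)) (b' := fun x => -E.mean (-x)) (θ := -θ) hord
    (E.continuousOn_b.comp continuousOn_neg fun _ hx => hx)
    ((E.continuousOn_mean hΘ).comp continuousOn_neg fun _ hx => hx).neg
    (fun x hx y hy hne => by
      have := E.tangent_lt hΘ hx hy (neg_injective.ne hne)
      linarith)
    (by simpa using hθ)
  refine ⟨fun c => -g c, hg.neg, hgΘ, fun y hy hyθ c hc0 hc => ?_⟩
  have := hgc (-y) (by simpa using hy) (neg_le_neg hyθ) c hc0
    (by simp only [neg_neg]; unfold bregman at hc; linarith)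
  simp only [neg_neg] at this
  linarith

end ExpFamily

/-! ### Test functions: mixtures of likelihood ratios -/

/-- `f n s` depends on the number `n` of samples from `ν` and on their sum `s`, has initial value
at most one, and is a supermartingale along i.i.d. samples from `ν`. -/
structure IsTestFun (ν : Measure ℝ) (f : ℕ → ℝ → ℝ≥0∞) : Prop where
  measurable : ∀ n, Measurable (f n)
  init_le : f 0 0 ≤ 1
  step_le : ∀ n s, ∫⁻ x, f (n + 1) (s + x) ∂ν ≤ f n s

namespace IsTestFun

variable {ν : Measure ℝ}

/-- By Tonelli, averaging over a parameter preserves the supermartingale inequality. -/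
theorem lintegral [SFinite ν] {ι : Type*} [MeasurableSpace ι] {ρ : Measure ι}
    [IsProbabilityMeasure ρ] {F : ι → ℕ → ℝ → ℝ≥0∞}
    (hm : ∀ n, Measurable fun p : ι × ℝ => F p.1 n p.2) (hF : ∀ i, IsTestFun ν (F i)) :
    IsTestFun ν fun n s => ∫⁻ i, F i n s ∂ρ where
  measurable n := (hm n).lintegral_prod_left'
  init_le := (lintegral_mono fun i => (hF i).init_le).trans (by simp)
  step_le n s := by
    have hm' : Measurable fun p : ℝ × ι => F p.2 (n + 1) (s + p.1) :=
      (hm (n + 1)).comp (measurable_snd.prodMk (measurable_fst.const_add s))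
    rw [lintegral_lintegral_swap hm'.aemeasurable]
    exact lintegral_mono fun i => (hF i).step_le n s

theorem tsum {w : ℕ → ℝ≥0∞} (hw : ∑' i, w i ≤ 1) {F : ℕ → ℕ → ℝ → ℝ≥0∞}
    (hF : ∀ i, IsTestFun ν (F i)) : IsTestFun ν fun n s => ∑' i, w i * F i n s where
  measurable n := Measurable.tsum fun i => ((hF i).measurable n).const_mul _
  init_le := (ENNReal.tsum_le_tsum fun i =>
    (mul_le_mul_right (hF i).init_le (w i)).trans_eq (mul_one _)).trans hw
  step_le n s := by
    have hm : ∀ i, Measurable fun x => F i (n + 1) (s + x) := fun i =>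
      ((hF i).measurable (n + 1)).comp (measurable_id.const_add s)
    rw [lintegral_tsum fun i => ((hm i).const_mul _).aemeasurable]
    refine ENNReal.tsum_le_tsum fun i => ?_
    rw [lintegral_const_mul _ (hm i)]
    exact mul_le_mul_right ((hF i).step_le n s) _

theorem add {w₁ w₂ : ℝ≥0∞} (hw : w₁ + w₂ ≤ 1) {f₁ f₂ : ℕ → ℝ → ℝ≥0∞} (h₁ : IsTestFun ν f₁)
    (h₂ : IsTestFun ν f₂) : IsTestFun ν fun n s => w₁ * f₁ n s + w₂ * f₂ n s where
  measurable n := ((h₁.measurable n).const_mul _).add ((h₂.measurable n).const_mul _)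
  init_le := (add_le_add ((mul_le_mul_right h₁.init_le w₁).trans_eq (mul_one _))
    ((mul_le_mul_right h₂.init_le w₂).trans_eq (mul_one _))).trans hw
  step_le n s := by
    have hm₁ : Measurable fun x => f₁ (n + 1) (s + x) :=
      (h₁.measurable (n + 1)).comp (measurable_id.const_add s)
    have hm₂ : Measurable fun x => f₂ (n + 1) (s + x) :=
      (h₂.measurable (n + 1)).comp (measurable_id.const_add s)
    rw [lintegral_add_left (hm₁.const_mul _), lintegral_const_mul _ hm₁,
      lintegral_const_mul _ hm₂]
    exact add_le_add (mul_le_mul_right (h₁.step_le n s) _) (mul_le_mul_right (h₂.step_le n s) _)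

theorem one [IsProbabilityMeasure ν] : IsTestFun ν fun _ _ => 1 where
  measurable _ := measurable_const
  init_le := le_rfl
  step_le _ _ := by simp

end IsTestFun

/-- Test functions detecting every level `u ≥ 0` combine into one that is exponentially large in
the highest level reached. -/
theorem IsTestFun.exists_exp_mixture {ν : Measure ℝ} [IsProbabilityMeasure ν]
    {F : ℝ → ℕ → ℝ → ℝ≥0∞} (hFmeas : ∀ n, Measurable fun p : ℝ × ℝ => F p.1 n p.2)
    (hFtest : ∀ u, IsTestFun ν (F u)) {lam : ℝ} (hl0 : 0 < lam) (hl1 : lam < 1) :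
    ∃ f, IsTestFun ν f ∧ ∀ n s Y, (∀ u, 0 ≤ u → u ≤ Y → ENNReal.ofReal (Real.exp u) ≤ F u n s) →
      ENNReal.ofReal ((1 - lam) * Real.exp (lam * Y)) ≤ f n s := by
  have hl : 0 < 1 - lam := sub_pos.2 hl1
  have hρ : IsProbabilityMeasure (expMeasure (1 - lam)) := isProbabilityMeasure_expMeasure hl
  -- The level is drawn from the exponential law of rate `1 - lam`. Levels in `(0, Y]` contribute
  -- `lam * ∫ (1 - lam) exp (lam u) du = (1 - lam) (exp (lam Y) - 1)`, and the constant test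
  -- function with weight `1 - lam` supplies the missing `1 - lam`; alone it covers `Y ≤ 0`.
  refine ⟨_, IsTestFun.add (w₁ := ENNReal.ofReal (1 - lam)) (w₂ := ENNReal.ofReal lam) ?_
    IsTestFun.one (IsTestFun.lintegral (ρ := expMeasure (1 - lam)) hFmeas hFtest), ?_⟩
  · rw [← ENNReal.ofReal_add hl.le hl0.le]
    simp
  intro n s Y hY
  rw [mul_one]
  rcases le_or_gt Y 0 with hY0 | hY0
  · refine le_trans (ENNReal.ofReal_le_ofReal ?_) le_self_add
    exact mul_le_of_le_one_right hl.le
      (Real.exp_le_one_iff.2 (mul_nonpos_of_nonneg_of_nonpos hl0.le hY0))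
  · have hint : ∫ u in (0 : ℝ)..Y, (1 - lam) * Real.exp (lam * u)
        = (1 - lam) / lam * (Real.exp (lam * Y) - 1) := by
      have hd : ∀ u ∈ Set.uIcc 0 Y, HasDerivAt (fun u => (1 - lam) / lam * Real.exp (lam * u))
          ((1 - lam) * Real.exp (lam * u)) u := by
        intro u _
        have := (((hasDerivAt_id u).const_mul lam).exp).const_mul ((1 - lam) / lam)
        refine this.congr_deriv ?_
        simp only [id, mul_one]
        field_simp
      rw [intervalIntegral.integral_eq_sub_of_hasDerivAt hd
        (Continuous.intervalIntegrable (by fun_prop) _ _)]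
      simp
      ring
    have hlow : ENNReal.ofReal ((1 - lam) / lam * (Real.exp (lam * Y) - 1))
        ≤ ∫⁻ u, F u n s ∂(expMeasure (1 - lam)) := by
      rw [← hint, intervalIntegral.integral_of_le hY0.le,
        ofReal_integral_eq_lintegral_ofReal
          (Continuous.integrableOn_Ioc (by fun_prop))
          (Filter.Eventually.of_forall fun u => by positivity)]
      have hmF : Measurable fun u => F u n s :=
        (hFmeas n).comp (measurable_id.prodMk measurable_const)
      have hpdf : Measurable (exponentialPDF (1 - lam)) :=
        (measurable_exponentialPDFReal _).ennreal_ofReal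
      rw [show expMeasure (1 - lam) = volume.withDensity (exponentialPDF (1 - lam)) from rfl,
        lintegral_withDensity_eq_lintegral_mul _ hpdf hmF]
      refine le_trans ?_ (setLIntegral_le_lintegral (Set.Ioc 0 Y) _)
      refine setLIntegral_mono' measurableSet_Ioc fun u hu => ?_
      simp only [Pi.mul_apply]
      rw [exponentialPDF_of_nonneg hu.1.le]
      refine le_trans ?_ (mul_le_mul_right (hY u hu.1.le hu.2) _)
      rw [← ENNReal.ofReal_mul (by positivity), mul_assoc, ← Real.exp_add]
      refine le_of_eq ?_
      congr 3
      ring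
    refine le_trans (le_of_eq ?_) (add_le_add le_rfl (mul_le_mul_right hlow _))
    have h1 : 0 ≤ Real.exp (lam * Y) - 1 :=
      sub_nonneg.2 (Real.one_le_exp (by positivity))
    rw [← ENNReal.ofReal_mul hl0.le, ← ENNReal.ofReal_add hl.le (by positivity)]
    congr 1
    field_simp
    ring

/-! ### Mixing likelihood ratios over geometric slices of the sample count -/

namespace ExpFamily

variable (E : ExpFamily) {θ θ' : ℝ}

/-- The likelihood ratio of `ν_θ'` against `ν_θ` of `n` samples with sum `s`. -/
noncomputable def likelihood (θ θ' : ℝ) (n : ℕ) (s : ℝ) : ℝ≥0∞ :=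
  ENNReal.ofReal (Real.exp ((θ' - θ) * s - n * (E.b θ' - E.b θ)))

theorem isTestFun_likelihood (θ : ℝ) (hθ' : θ' ∈ E.Θ) :
    IsTestFun (E.law θ) (E.likelihood θ θ') where
  measurable n := by unfold likelihood; fun_prop
  init_le := by simp [likelihood]
  step_le n s := by
    have h1 : ∀ x, E.likelihood θ θ' (n + 1) (s + x) = E.likelihood θ θ' n s
        * ENNReal.ofReal (Real.exp ((θ' - θ) * x - (E.b θ' - E.b θ))) := by
      intro x
      unfold likelihood
      rw [← ENNReal.ofReal_mul (Real.exp_pos _).le, ← Real.exp_add]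
      congr 2
      push_cast
      ring
    simp_rw [h1]
    rw [lintegral_const_mul _ (by fun_prop), E.lintegral_likelihood θ hθ', mul_one]

/-- `E.b` is arbitrary outside `E.Θ`, so measurability has to pass through the subtype. -/
theorem measurable_b_comp {ι : Type*} [MeasurableSpace ι] {g : ι → ℝ} (hg : Measurable g)
    (hgΘ : ∀ c, g c ∈ E.Θ) : Measurable fun c => E.b (g c) :=
  (continuousOn_iff_continuous_domRestrict.1 E.continuousOn_b).measurable.comp
    (hg.subtype_mk (h := hgΘ))

theorem measurable_likelihood_comp {ι : Type*} [MeasurableSpace ι] {g : ι → ℝ}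
    (hg : Measurable g) (hgΘ : ∀ c, g c ∈ E.Θ) (n : ℕ) :
    Measurable fun p : ι × ℝ => E.likelihood θ (g p.1) n p.2 := by
  have hb := E.measurable_b_comp hg hgΘ
  exact ((((hg.comp measurable_fst).sub_const θ).mul measurable_snd).sub
    (((hb.comp measurable_fst).sub_const _).const_mul _)).exp.ennreal_ofReal

/-- The divergence that a slice `η ^ i ≤ n ≤ η ^ (i + 1)` has to detect at level `u`. -/
noncomputable def sliceLevel (η : ℝ) (i : ℕ) (u : ℝ) : ℝ :=
  η * (u + Real.log (2 * zetaTwo) + 2 * Real.log (i + 1)) / η ^ (i + 1)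

theorem tsum_sliceWeight : ∑' i : ℕ, ENNReal.ofReal (1 / (zetaTwo * ((i : ℝ) + 1) ^ 2)) ≤ 1 := by
  have hz : 0 < zetaTwo := one_pos.trans_le one_le_zetaTwo
  have hs : HasSum (fun i : ℕ => 1 / (zetaTwo * ((i : ℝ) + 1) ^ 2)) 1 := by
    have := hasSum_zetaTwo.mul_left (1 / zetaTwo)
    rw [one_div_mul_cancel hz.ne'] at this
    simpa only [one_div_mul_one_div] using this
  rw [← ENNReal.ofReal_tsum_of_nonneg (fun i => by positivity) hs.summable, hs.tsum_eq,
    ENNReal.ofReal_one]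

/-- The cost `2 ln(i + 1)` of the weight of slice `i` becomes the iterated logarithm: `(i + 1) ln η
≤ ln n + ln η ≤ 1 + ln n`. The constant `3` of the threshold is the bound on `2 η`. -/
theorem log_succ_floor_le {η : ℝ} (hη : 1 < η) (hη' : η ≤ 3 / 2) (n : ℕ) :
    2 * η * (Real.log ((⌊Real.log n / Real.log η⌋₊ : ℝ) + 1) + Real.log (Real.log η))
      ≤ 3 * Real.log (1 + Real.log n) := by
  have hlη : 0 < Real.log η := Real.log_pos hη
  have hlη1 : Real.log η ≤ 1 := by
    have := Real.log_le_sub_one_of_pos (one_pos.trans hη)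
    linarith
  have hln : 0 ≤ Real.log n := Real.log_natCast_nonneg n
  rw [← Real.log_mul (by positivity) hlη.ne']
  have hfl : (⌊Real.log n / Real.log η⌋₊ : ℝ) ≤ Real.log n / Real.log η :=
    Nat.floor_le (by positivity)
  rw [le_div_iff₀ hlη] at hfl
  have h1 : Real.log (((⌊Real.log n / Real.log η⌋₊ : ℝ) + 1) * Real.log η)
      ≤ Real.log (1 + Real.log n) :=
    Real.log_le_log (by positivity) (by linarith)
  have h2 : 0 ≤ Real.log (1 + Real.log n) := Real.log_nonneg (by linarith)
  have h3 := mul_le_mul_of_nonneg_left h1 (show 0 ≤ 2 * η by linarith)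
  nlinarith

/-- The mixture over slices detects level `u` whenever the divergence is large enough. -/
theorem exp_le_tsum_likelihood {η : ℝ} (hη : 1 < η) (hη' : η ≤ 3 / 2) {gp gm : ℝ → ℝ}
    (hp : ∀ y ∈ E.Θ, θ ≤ y → ∀ c, 0 ≤ c → c ≤ E.bregman y θ →
      c ≤ (gp c - θ) * E.mean y - (E.b (gp c) - E.b θ))
    (hm : ∀ y ∈ E.Θ, y ≤ θ → ∀ c, 0 ≤ c → c ≤ E.bregman y θ →
      c ≤ (gm c - θ) * E.mean y - (E.b (gm c) - E.b θ))
    {n : ℕ} (hn : n ≠ 0) {y : ℝ} (hy : y ∈ E.Θ) {u : ℝ} (hu0 : 0 ≤ u)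
    (hu : u ≤ (n * E.bregman y θ - 3 * Real.log (1 + Real.log n)) / η
      - Real.log (2 * zetaTwo) + 2 * Real.log (Real.log η)) :
    ENNReal.ofReal (Real.exp u) ≤ ∑' i : ℕ, ENNReal.ofReal (1 / (zetaTwo * ((i : ℝ) + 1) ^ 2)) *
      (2⁻¹ * E.likelihood θ (gp (sliceLevel η i u)) n (n * E.mean y)
        + 2⁻¹ * E.likelihood θ (gm (sliceLevel η i u)) n (n * E.mean y)) := by
  have hη0 : 0 < η := one_pos.trans hη
  have hlη : 0 < Real.log η := Real.log_pos hη
  have hn0 : (0 : ℝ) < n := by exact_mod_cast Nat.pos_of_ne_zero hn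
  have hz : 0 < zetaTwo := one_pos.trans_le one_le_zetaTwo
  set i := ⌊Real.log n / Real.log η⌋₊ with hi
  set c := sliceLevel η i u with hc
  have hi1 : 0 ≤ Real.log ((i : ℝ) + 1) :=
    Real.log_nonneg (by linarith [(Nat.cast_nonneg i : (0 : ℝ) ≤ i)])
  have hlow : η ^ i ≤ n := by
    rw [← Real.log_le_log_iff (by positivity) hn0, Real.log_pow, ← le_div_iff₀ hlη]
    exact Nat.floor_le (div_nonneg (Real.log_natCast_nonneg n) hlη.le)
  have hupp : (n : ℝ) ≤ η ^ (i + 1) := by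
    rw [← Real.log_le_log_iff hn0 (by positivity), Real.log_pow, ← div_le_iff₀ hlη]
    push_cast
    exact (Nat.lt_floor_add_one _).le
  have hc0 : 0 ≤ c := by
    have := log_two_zetaTwo_pos
    simp only [hc, sliceLevel]
    positivity
  -- The upper end of the slice enters here: `n ≤ η ^ (i + 1)` makes the divergence of `y` at least
  -- the level assigned to the slice.
  have hcD : c ≤ E.bregman y θ := by
    have h1 := log_succ_floor_le hη hη' n
    rw [← hi] at h1
    have h2 : η * (u + Real.log (2 * zetaTwo) - 2 * Real.log (Real.log η))
        ≤ n * E.bregman y θ - 3 * Real.log (1 + Real.log n) := by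
      rw [mul_comm, ← le_div_iff₀ hη0]
      linarith
    have h3 : η * (u + Real.log (2 * zetaTwo) + 2 * Real.log (i + 1)) ≤ n * E.bregman y θ := by
      linarith
    have h4 : 0 ≤ η * (u + Real.log (2 * zetaTwo) + 2 * Real.log (i + 1)) := by
      have := log_two_zetaTwo_pos
      positivity
    have hD : 0 ≤ E.bregman y θ := nonneg_of_mul_nonneg_right (h4.trans h3) hn0
    simp only [hc, sliceLevel]
    rw [div_le_iff₀ (by positivity)]
    nlinarith
  -- The lower end of the slice enters here: `η ^ i ≤ n` gives `n * c ≥ u + ln(2 ζ(2) (i + 1)²)`.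
  -- The excess over `u` pays for the slice weight and for the factor `1/2` of the side.
  have hexp : ∀ g : ℝ, c ≤ (g - θ) * E.mean y - (E.b g - E.b θ) →
      ENNReal.ofReal (Real.exp u * (2 * (zetaTwo * ((i : ℝ) + 1) ^ 2)))
        ≤ E.likelihood θ g n (n * E.mean y) := by
    intro g hg
    refine ENNReal.ofReal_le_ofReal ?_
    have hpos : (0 : ℝ) < 2 * (zetaTwo * ((i : ℝ) + 1) ^ 2) := by positivity
    rw [← Real.exp_log hpos, ← Real.exp_add, Real.exp_le_exp]
    have h5 : Real.log (2 * (zetaTwo * ((i : ℝ) + 1) ^ 2))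
        = Real.log (2 * zetaTwo) + 2 * Real.log (i + 1) := by
      rw [← mul_assoc, Real.log_mul (by positivity) (by positivity), Real.log_pow]
      norm_num
    have h6 : η ^ i * c = u + Real.log (2 * zetaTwo) + 2 * Real.log (i + 1) := by
      simp only [hc, sliceLevel]
      rw [pow_succ]
      field_simp
    have h7 : η ^ i * c ≤ n * c := mul_le_mul_of_nonneg_right hlow hc0
    have h8 := mul_le_mul_of_nonneg_left hg hn0.le
    rw [h5]
    linarith
  refine le_trans ?_ (ENNReal.le_tsum i)
  have hw : ENNReal.ofReal (Real.exp u) = ENNReal.ofReal (1 / (zetaTwo * ((i : ℝ) + 1) ^ 2)) *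
      (2⁻¹ * ENNReal.ofReal (Real.exp u * (2 * (zetaTwo * ((i : ℝ) + 1) ^ 2)))) := by
    rw [show (2⁻¹ : ℝ≥0∞) = ENNReal.ofReal (2⁻¹) by
      rw [ENNReal.ofReal_inv_of_pos two_pos]; norm_num, ← ENNReal.ofReal_mul (by norm_num),
      ← ENNReal.ofReal_mul (by positivity)]
    congr 1
    field_simp
  rw [hw]
  refine mul_le_mul_right ?_ _
  rcases le_total θ y with hθy | hθy
  · exact (mul_le_mul_right (hexp _ (hp y hy hθy c hc0 hcD)) _).trans le_self_add
  · exact (mul_le_mul_right (hexp _ (hm y hy hθy c hc0 hcD)) _).trans le_add_self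

/-- A test function against `ν_θ` that grows at least like `exp (lam * Y)`, where `Y` is the
affinely rescaled and iterated-logarithm corrected divergence of the empirical mean. -/
theorem exists_isTestFun (hΘ : E.Θ.Nontrivial) (hθ : θ ∈ E.Θ) {lam η : ℝ} (hl0 : 0 < lam)
    (hl1 : lam < 1) (hη : 1 < η) (hη' : η ≤ 3 / 2) :
    ∃ f, IsTestFun (E.law θ) f ∧ ∀ n : ℕ, n ≠ 0 → ∀ y ∈ E.Θ,
      ENNReal.ofReal ((1 - lam) * Real.exp (lam *
        ((n * E.bregman y θ - 3 * Real.log (1 + Real.log n)) / η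
          - Real.log (2 * zetaTwo) + 2 * Real.log (Real.log η)))) ≤ f n (n * E.mean y) := by
  obtain ⟨gp, hgp, hgpΘ, hp⟩ := E.exists_selector_above hΘ hθ
  obtain ⟨gm, hgm, hgmΘ, hm⟩ := E.exists_selector_below hΘ hθ
  have := E.isProbabilityMeasure_law hθ
  set F : ℝ → ℕ → ℝ → ℝ≥0∞ := fun u n s =>
    ∑' i : ℕ, ENNReal.ofReal (1 / (zetaTwo * ((i : ℝ) + 1) ^ 2)) *
      (2⁻¹ * E.likelihood θ (gp (sliceLevel η i u)) n s
        + 2⁻¹ * E.likelihood θ (gm (sliceLevel η i u)) n s) with hF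
  have hFtest : ∀ u, IsTestFun (E.law θ) (F u) := fun u =>
    IsTestFun.tsum tsum_sliceWeight fun i =>
      IsTestFun.add (by rw [ENNReal.inv_two_add_inv_two])
        (E.isTestFun_likelihood θ (hgpΘ _)) (E.isTestFun_likelihood θ (hgmΘ _))
  have hlev : ∀ i, Measurable (sliceLevel η i) := fun i => by unfold sliceLevel; fun_prop
  have hFmeas : ∀ n, Measurable fun p : ℝ × ℝ => F p.1 n p.2 := fun n =>
    Measurable.tsum fun i => Measurable.const_mul
      (((E.measurable_likelihood_comp (hgp.comp (hlev i)) (fun c => hgpΘ _) n).const_mul _).add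
      ((E.measurable_likelihood_comp (hgm.comp (hlev i)) (fun c => hgmΘ _) n).const_mul _)) _
  obtain ⟨f, hf, hfY⟩ := IsTestFun.exists_exp_mixture hFmeas hFtest hl0 hl1
  exact ⟨f, hf, fun n hn y hy => hfY n _ _ fun u hu0 hu =>
    E.exp_le_tsum_likelihood hη hη' hp hm hn hy hu0 hu⟩

end ExpFamily

/-! ### Ville's inequality -/

/-- Ville's maximal inequality for an `ℝ≥0∞`-valued supermartingale. -/
theorem mul_measure_exists_le_lintegral {Ω : Type*} [m : MeasurableSpace Ω] (P : Measure Ω)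
    (ℱ : ℕ → MeasurableSpace Ω) (hmono : Monotone ℱ) (hle : ∀ t, ℱ t ≤ m) (Z : ℕ → Ω → ℝ≥0∞)
    (hZ : ∀ t, Measurable[ℱ t] (Z t))
    (hstep : ∀ t B, MeasurableSet[ℱ t] B → ∫⁻ ω in B, Z (t + 1) ω ∂P ≤ ∫⁻ ω in B, Z t ω ∂P)
    (c : ℝ≥0∞) : c * P {ω | ∃ t, c ≤ Z t ω} ≤ ∫⁻ ω, Z 0 ω ∂P := by
  set H : ℕ → Set Ω := fun t => {ω | c ≤ Z t ω} with hH
  have hHm : ∀ t, MeasurableSet[ℱ t] (H t) := fun t =>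
    measurableSet_le measurable_const (hZ t)
  set S : ℕ → Set Ω := fun t => ⋃ s ≤ t, H s with hS
  have hSm : ∀ t, MeasurableSet[ℱ t] (S t) := fun t =>
    MeasurableSet.biUnion (m := ℱ t) (Set.to_countable _) fun s hs => hmono hs _ (hHm s)
  have hSsucc : ∀ t, S (t + 1) = S t ∪ H (t + 1) := by
    intro t
    ext ω
    simp only [hS, Set.mem_iUnion, Set.mem_union, exists_prop, Nat.le_succ_iff]
    constructor
    · rintro ⟨s, hs | rfl, h⟩
      · exact Or.inl ⟨s, hs, h⟩
      · exact Or.inr h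
    · rintro (⟨s, hs, h⟩ | h)
      · exact ⟨s, Or.inl hs, h⟩
      · exact ⟨t + 1, Or.inr rfl, h⟩
  have hmarkov : ∀ t B, MeasurableSet B → c * P (B ∩ H t) ≤ ∫⁻ ω in B ∩ H t, Z t ω ∂P := by
    intro t B hB
    rw [← setLIntegral_const]
    exact setLIntegral_mono' (hB.inter (hle t _ (hHm t))) fun ω hω => hω.2
  -- The left side bounds from below the expectation of `Z` stopped when it first reaches `c`. In
  -- the induction, paths not yet stopped obey the supermartingale inequality, and those that now
  -- reach `c` are charged by Markov's inequality.
  have key : ∀ t, c * P (S t) + ∫⁻ ω in (S t)ᶜ, Z t ω ∂P ≤ ∫⁻ ω, Z 0 ω ∂P := by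
    intro t
    induction t with
    | zero =>
      have h0 : S 0 = H 0 := by ext ω; simp [hS]
      have := hmarkov 0 Set.univ MeasurableSet.univ
      rw [Set.univ_inter] at this
      rw [h0]
      exact (add_le_add this le_rfl).trans_eq (lintegral_add_compl (Z 0) (hle 0 _ (hHm 0)))
    | succ t ih =>
      refine le_trans ?_ ih
      have hB : MeasurableSet (S t)ᶜ := (hle t _ (hSm t)).compl
      have hc : (S (t + 1))ᶜ = (S t)ᶜ \ H (t + 1) := by
        rw [hSsucc, Set.compl_union, Set.sdiff_eq]
      have hu : S (t + 1) = S t ∪ ((S t)ᶜ ∩ H (t + 1)) := by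
        rw [hSsucc, Set.union_inter_distrib_left, Set.union_compl_self, Set.univ_inter]
      have h1 : P (S (t + 1)) ≤ P (S t) + P ((S t)ᶜ ∩ H (t + 1)) := by
        rw [hu]
        exact measure_union_le _ _
      calc c * P (S (t + 1)) + ∫⁻ ω in (S (t + 1))ᶜ, Z (t + 1) ω ∂P
          ≤ c * (P (S t) + P ((S t)ᶜ ∩ H (t + 1)))
              + ∫⁻ ω in (S t)ᶜ \ H (t + 1), Z (t + 1) ω ∂P := by
            rw [hc]; gcongr
        _ ≤ c * P (S t) + (∫⁻ ω in (S t)ᶜ ∩ H (t + 1), Z (t + 1) ω ∂P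
              + ∫⁻ ω in (S t)ᶜ \ H (t + 1), Z (t + 1) ω ∂P) := by
            rw [mul_add, add_assoc]
            gcongr
            exact hmarkov (t + 1) _ hB
        _ = c * P (S t) + ∫⁻ ω in (S t)ᶜ, Z (t + 1) ω ∂P := by
            rw [lintegral_inter_add_sdiff _ _ (hle _ _ (hHm (t + 1)))]
        _ ≤ c * P (S t) + ∫⁻ ω in (S t)ᶜ, Z t ω ∂P := 
            add_le_add le_rfl (hstep t _ (hSm t).compl)
  have hSmono : Monotone S := fun s t hst =>
    Set.biUnion_subset_biUnion_left fun r hr => le_trans hr hst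
  have hunion : {ω | ∃ t, c ≤ Z t ω} = ⋃ t, S t := by
    ext ω
    simp only [hS, hH, Set.mem_ofPred_eq, Set.mem_iUnion, exists_prop]
    exact ⟨fun ⟨t, h⟩ => ⟨t, t, le_rfl, h⟩, fun ⟨_, s, _, h⟩ => ⟨s, h⟩⟩
  rw [hunion, hSmono.measure_iUnion, ENNReal.mul_iSup]
  exact iSup_le fun t => le_self_add.trans (key t)

/-! ### Products of test functions along a bandit run -/

theorem history_mono {Ω : Type*} {K : ℕ} (A : ℕ → Ω → Fin K) (X : ℕ → Ω → ℝ) : Monotone (history A X) :=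
  fun _ _ hst => biSup_mono fun _ hr => hr.trans_le hst

theorem measurable_arm_history {Ω : Type*} {K : ℕ} (A : ℕ → Ω → Fin K) (X : ℕ → Ω → ℝ) {s t : ℕ} (hst : s < t) :
    Measurable[history A X t] (A s) :=
  (comap_measurable (A s)).mono (le_sup_left.trans (le_biSup (fun s =>
    MeasurableSpace.comap (A s) inferInstance ⊔ MeasurableSpace.comap (X s) inferInstance) hst))
    le_rfl

theorem measurable_sample_history {Ω : Type*} {K : ℕ} (A : ℕ → Ω → Fin K) (X : ℕ → Ω → ℝ) {s t : ℕ} (hst : s < t) :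
    Measurable[history A X t] (X s) :=
  (comap_measurable (X s)).mono (le_sup_right.trans (le_biSup (fun s =>
    MeasurableSpace.comap (A s) inferInstance ⊔ MeasurableSpace.comap (X s) inferInstance) hst))
    le_rfl

/-- The sum of the samples of arm `a` in the first `t` rounds. -/
def armSum {K : ℕ} (A : ℕ → Fin K) (X : ℕ → ℝ) (t : ℕ) (a : Fin K) : ℝ :=
  ∑ s ∈ (Finset.range t).filter fun s => A s = a, X s

theorem count_succ {K : ℕ} (A : ℕ → Fin K) (t : ℕ) (a : Fin K) :
    count A (t + 1) a = count A t a + if A t = a then 1 else 0 := by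
  unfold count
  rw [Finset.range_add_one, Finset.filter_insert]
  split_ifs
  · rw [Finset.card_insert_of_notMem (by simp)]
  · simp

theorem armSum_succ {K : ℕ} (A : ℕ → Fin K) (X : ℕ → ℝ) (t : ℕ) (a : Fin K) :
    armSum A X (t + 1) a = armSum A X t a + if A t = a then X t else 0 := by
  unfold armSum
  rw [Finset.range_add_one, Finset.filter_insert]
  split_ifs
  · rw [Finset.sum_insert (by simp), add_comm]
  · simp

theorem sum_count {K : ℕ} (A : ℕ → Fin K) (t : ℕ) : ∑ a, count A t a = t := by
  unfold count
  rw [Finset.sum_card_fiberwise_eq_card_filter]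
  simp

theorem measurable_count_history {Ω : Type*} {K : ℕ} (A : ℕ → Ω → Fin K) (X : ℕ → Ω → ℝ) (t : ℕ) (a : Fin K) :
    Measurable[history A X t] fun ω => count (fun s => A s ω) t a := by
  have h : (fun ω => count (fun s => A s ω) t a)
      = fun ω => ∑ s ∈ Finset.range t, if A s ω = a then 1 else 0 := by
    ext ω
    exact Finset.card_filter _ _
  rw [h]
  refine Finset.measurable_fun_sum _ fun s hs => ?_
  have hm := measurable_arm_history A X (Finset.mem_range.1 hs)
  exact Measurable.ite (hm (measurableSet_singleton a))
    measurable_const measurable_const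

theorem measurable_armSum_history {Ω : Type*} {K : ℕ} (A : ℕ → Ω → Fin K) (X : ℕ → Ω → ℝ) (t : ℕ) (a : Fin K) :
    Measurable[history A X t] fun ω => armSum (fun s => A s ω) (fun s => X s ω) t a := by
  have h : (fun ω => armSum (fun s => A s ω) (fun s => X s ω) t a)
      = fun ω => ∑ s ∈ Finset.range t, if A s ω = a then X s ω else 0 := by
    ext ω
    exact Finset.sum_filter _ _
  rw [h]
  refine Finset.measurable_fun_sum _ fun s hs => ?_
  have hm := measurable_arm_history A X (Finset.mem_range.1 hs)
  exact Measurable.ite (hm (measurableSet_singleton a))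
    (measurable_sample_history A X (Finset.mem_range.1 hs)) measurable_const

/-! ### The supermartingale property under an arbitrary sampling rule -/

section Run

variable {Ω : Type*} [m : MeasurableSpace Ω] {K : ℕ} {E : ExpFamily} {μ : Fin K → ℝ}
  {P : Measure Ω} {A : ℕ → Ω → Fin K} {X : ℕ → Ω → ℝ}

theorem IsBanditRun.history_le (hrun : IsBanditRun E μ P A X) (t : ℕ) : history A X t ≤ m :=
  iSup₂_le fun s _ => sup_le (hrun.measurable_arm s).comap_le (hrun.measurable_sample s).comap_le

/-- On a set of the past on which arm `a` is selected, the sample is independent of the past with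
law `ν^{μ_a}`. -/
theorem IsBanditRun.setLIntegral_eq [IsProbabilityMeasure P] (hrun : IsBanditRun E μ P A X)
    {t : ℕ} {a : Fin K} [IsProbabilityMeasure (E.arm (μ a))] {B : Set Ω}
    (hB : MeasurableSet[history A X t] B) {β : Type*} [MeasurableSpace β] {Ψ : Ω → β}
    (hΨ : Measurable[history A X t] Ψ) {F : β × ℝ → ℝ≥0∞} (hF : Measurable F) :
    ∫⁻ ω in B ∩ A t ⁻¹' {a}, F (Ψ ω, X t ω) ∂P
      = ∫⁻ ω in B ∩ A t ⁻¹' {a}, ∫⁻ x, F (Ψ ω, x) ∂(E.arm (μ a)) ∂P := by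
  set D := B ∩ A t ⁻¹' {a} with hD
  have hle : history A X t ⊔ MeasurableSpace.comap (A t) inferInstance ≤ m := sup_le (hrun.history_le t) (hrun.measurable_arm t).comap_le
  have hX := hrun.measurable_sample t
  have hΨm : Measurable Ψ := hΨ.mono (hrun.history_le t) le_rfl
  have hDG : MeasurableSet[history A X t ⊔ MeasurableSpace.comap (A t) inferInstance] D :=
    MeasurableSet.inter ((le_sup_left : history A X t ≤ _) _ hB)
      ((le_sup_right : MeasurableSpace.comap (A t) inferInstance ≤ _) _
        ⟨{a}, measurableSet_singleton a, rfl⟩)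
  -- On `D` the pair of past statistic and new sample has a product law. Rectangles suffice, and
  -- there the identity is `cond_law` integrated over `Ψ ⁻¹' s ∩ D`, a set known once the past and
  -- the current arm are known.
  have hprod : ((P.restrict D).map Ψ).prod (E.arm (μ a))
      = (P.restrict D).map fun ω => (Ψ ω, X t ω) := by
    refine Measure.prod_eq fun s C hs hC => ?_
    have hsG : MeasurableSet[history A X t ⊔ MeasurableSpace.comap (A t) inferInstance] (Ψ ⁻¹' s ∩ D) :=
      MeasurableSet.inter ((le_sup_left : history A X t ≤ _) _ (hΨ hs)) hDG
    have hsm : MeasurableSet (Ψ ⁻¹' s ∩ D) := hle _ hsG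
    rw [Measure.map_apply (hΨm.prodMk hX) (hs.prod hC), Measure.map_apply hΨm hs,
      Measure.restrict_apply (hΨm hs), Measure.restrict_apply ((hΨm.prodMk hX) (hs.prod hC))]
    have hint : Integrable ((X t ⁻¹' C).indicator fun _ => (1 : ℝ)) P :=
      (integrable_const 1).indicator (hX hC)
    have h1 := setIntegral_condExp hle hint hsG
    rw [setIntegral_congr_ae (g := fun _ => (E.arm (μ a)).real C) hsm
      ((hrun.cond_law t C hC).mono fun ω hω hωD => by
        have hA : A t ω = a := hωD.2.2
        simp only [hω, hA]), setIntegral_const,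
      integral_indicator_const (1 : ℝ) (hX hC)] at h1
    simp only [smul_eq_mul, mul_one] at h1
    rw [measureReal_restrict_apply (hX hC)] at h1
    have hset : (fun ω => (Ψ ω, X t ω)) ⁻¹' s ×ˢ C ∩ D = X t ⁻¹' C ∩ (Ψ ⁻¹' s ∩ D) := by
      ext ω
      simp only [Set.mem_inter_iff, Set.mem_preimage, Set.mem_prod]
      tauto
    rw [hset, ← ofReal_measureReal, ← h1, ENNReal.ofReal_mul measureReal_nonneg,
      ofReal_measureReal, ofReal_measureReal]
  rw [← lintegral_map (f := F) (g := fun ω => (Ψ ω, X t ω)) hF (hΨm.prodMk hX), ← hprod,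
    lintegral_prod _ hF.aemeasurable, lintegral_map hF.lintegral_prod_right' hΨm]

/-- The product over the arms in `S` of test functions evaluated at the data of the arms. -/
noncomputable def testProcess {K : ℕ} (f : Fin K → ℕ → ℝ → ℝ≥0∞) (S : Finset (Fin K))
    (A : ℕ → Fin K) (X : ℕ → ℝ) (t : ℕ) : ℝ≥0∞ :=
  ∏ a ∈ S, f a (count A t a) (armSum A X t a)

theorem measurable_testFun_history {Ω : Type*} {K : ℕ} {ν : Measure ℝ} {f : ℕ → ℝ → ℝ≥0∞} (hf : IsTestFun ν f)
    (A : ℕ → Ω → Fin K) (X : ℕ → Ω → ℝ) (t : ℕ) (a : Fin K) :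
    Measurable[history A X t] fun ω =>
      f (count (fun s => A s ω) t a) (armSum (fun s => A s ω) (fun s => X s ω) t a) := by
  have hu : Measurable fun p : ℕ × ℝ => f p.1 p.2 :=
    measurable_from_prod_countable_right hf.measurable
  exact hu.comp (Measurable.prodMk
    (measurable_count_history A X t a) (measurable_armSum_history A X t a))

theorem measurable_testProcess_history {Ω : Type*} {K : ℕ} {ν : Fin K → Measure ℝ} {f : Fin K → ℕ → ℝ → ℝ≥0∞}
    (hf : ∀ a, IsTestFun (ν a) (f a)) (S : Finset (Fin K)) (A : ℕ → Ω → Fin K) (X : ℕ → Ω → ℝ)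
    (t : ℕ) : Measurable[history A X t] fun ω =>
      testProcess f S (fun s => A s ω) (fun s => X s ω) t :=
  Finset.measurable_fun_prod _ fun a _ =>
    measurable_testFun_history (hf a) A X t a

/-- Split according to the selected arm. Only the factor of that arm changes, the other factors are
determined by the past, and `IsTestFun.step_le` controls the new sample. If the arm is outside `S`,
nothing changes. -/
theorem IsBanditRun.setLIntegral_testProcess_succ_le [IsProbabilityMeasure P]
    (hrun : IsBanditRun E μ P A X) (hμ : ∀ a, IsProbabilityMeasure (E.arm (μ a)))
    {f : Fin K → ℕ → ℝ → ℝ≥0∞} (hf : ∀ a, IsTestFun (E.arm (μ a)) (f a)) (S : Finset (Fin K))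
    (t : ℕ) {B : Set Ω} (hB : MeasurableSet[history A X t] B) :
    ∫⁻ ω in B, testProcess f S (fun s => A s ω) (fun s => X s ω) (t + 1) ∂P
      ≤ ∫⁻ ω in B, testProcess f S (fun s => A s ω) (fun s => X s ω) t ∂P := by
  have hBm : MeasurableSet B := hrun.history_le t _ hB
  have hDm : ∀ a, MeasurableSet (B ∩ A t ⁻¹' {a}) := fun a =>
    hBm.inter (hrun.measurable_arm t (measurableSet_singleton a))
  have hU : B = ⋃ a, B ∩ A t ⁻¹' {a} := by
    ext ω
    simp
  have hdisj : Pairwise (Function.onFun Disjoint fun a => B ∩ A t ⁻¹' {a}) := by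
    intro a a' haa
    refine Set.disjoint_left.2 fun ω h h' => haa ?_
    rw [← show A t ω = a from h.2, ← show A t ω = a' from h'.2]
  rw [hU, lintegral_iUnion hDm hdisj, lintegral_iUnion hDm hdisj]
  refine ENNReal.tsum_le_tsum fun a => ?_
  by_cases haS : a ∈ S
  · have := hμ a
    have hu : Measurable fun p : ℕ × ℝ => f a p.1 p.2 :=
      measurable_from_prod_countable_right (hf a).measurable
    have hF : Measurable fun p : (ℝ≥0∞ × ℕ × ℝ) × ℝ =>
        p.1.1 * f a (p.1.2.1 + 1) (p.1.2.2 + p.2) := by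
      refine measurable_fst.fst.mul (hu.comp (Measurable.prodMk ?_ ?_))
      · exact (measurable_of_countable fun n : ℕ => n + 1).comp measurable_fst.snd.fst
      · exact measurable_fst.snd.snd.add measurable_snd
    have hΨ : Measurable[history A X t] fun ω =>
        (testProcess f (S.erase a) (fun s => A s ω) (fun s => X s ω) t,
          count (fun s => A s ω) t a, armSum (fun s => A s ω) (fun s => X s ω) t a) :=
      Measurable.prodMk
        (measurable_testProcess_history hf _ A X t)
        (Measurable.prodMk
          (measurable_count_history A X t a) (measurable_armSum_history A X t a))
    have hsucc : ∀ ω ∈ B ∩ A t ⁻¹' {a},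
        testProcess f S (fun s => A s ω) (fun s => X s ω) (t + 1)
          = testProcess f (S.erase a) (fun s => A s ω) (fun s => X s ω) t *
            f a (count (fun s => A s ω) t a + 1)
              (armSum (fun s => A s ω) (fun s => X s ω) t a + X t ω) := by
      intro ω hω
      have hA : A t ω = a := hω.2
      unfold testProcess
      rw [← Finset.prod_erase_mul S _ haS, count_succ, armSum_succ, if_pos hA, if_pos hA]
      congr 1
      refine Finset.prod_congr rfl fun a' ha' => ?_
      have hne : A t ω ≠ a' := fun h => (Finset.ne_of_mem_erase ha') (h.symm.trans hA)
      rw [count_succ, armSum_succ, if_neg hne, if_neg hne, add_zero, add_zero]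
    rw [setLIntegral_congr_fun (hDm a) hsucc, hrun.setLIntegral_eq hB hΨ hF]
    refine lintegral_mono fun ω => ?_
    simp only
    have hm : Measurable fun x => f a (count (fun s => A s ω) t a + 1)
        (armSum (fun s => A s ω) (fun s => X s ω) t a + x) :=
      ((hf a).measurable _).comp (measurable_id.const_add _)
    rw [lintegral_const_mul _ hm]
    refine (mul_le_mul_right ((hf a).step_le _ _) _).trans_eq ?_
    exact Finset.prod_erase_mul S _ haS
  · refine le_of_eq (setLIntegral_congr_fun (hDm a) fun ω hω => ?_)
    have hA : A t ω = a := hω.2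
    refine Finset.prod_congr rfl fun a' ha' => ?_
    have hne : A t ω ≠ a' := fun h => haS (by rwa [← hA, h])
    rw [count_succ, armSum_succ, if_neg hne, if_neg hne, add_zero, add_zero]

theorem IsBanditRun.mul_measure_testProcess_le [IsProbabilityMeasure P]
    (hrun : IsBanditRun E μ P A X) (hμ : ∀ a, IsProbabilityMeasure (E.arm (μ a)))
    {f : Fin K → ℕ → ℝ → ℝ≥0∞} (hf : ∀ a, IsTestFun (E.arm (μ a)) (f a)) (S : Finset (Fin K))
    (c : ℝ≥0∞) :
    c * P {ω | ∃ t, c ≤ testProcess f S (fun s => A s ω) (fun s => X s ω) t} ≤ 1 := by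
  refine (mul_measure_exists_le_lintegral P (history A X) (history_mono A X) hrun.history_le
    (fun t ω => testProcess f S (fun s => A s ω) (fun s => X s ω) t)
    (measurable_testProcess_history hf S A X)
    (fun t B hB => hrun.setLIntegral_testProcess_succ_le hμ hf S t hB) c).trans ?_
  have h0 : ∀ ω, testProcess f S (fun s => A s ω) (fun s => X s ω) 0 ≤ 1 := fun ω =>
    Finset.prod_le_one' fun a _ => by simpa [count, armSum] using (hf a).init_le
  exact (lintegral_mono h0).trans (by simp)

end Run

/-! ### The deviation inequality -/

section Deviation

variable {Ω : Type*} [MeasurableSpace Ω] {K : ℕ} {E : ExpFamily} {μ : Fin K → ℝ}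
  {P : Measure Ω} {A : ℕ → Ω → Fin K} {X : ℕ → Ω → ℝ}

/-- The divergence of the empirical mean of arm `a` from `μ a`, times the number of samples. -/
noncomputable def armDiv (E : ExpFamily) {K : ℕ} (μ : Fin K → ℝ) (A : ℕ → Fin K) (X : ℕ → ℝ)
    (t : ℕ) (a : Fin K) : ℝ :=
  count A t a * E.bregman (E.param (empMean A X t a)) (E.param (μ a))

theorem armDiv_nonneg (hΘ : E.Θ.Nontrivial) {A : ℕ → Fin K} {X : ℕ → ℝ} {t : ℕ} {a : Fin K}
    (ha : empMean A X t a ∈ E.meanSet) (hμ : μ a ∈ E.meanSet) : 0 ≤ armDiv E μ A X t a :=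
  mul_nonneg (Nat.cast_nonneg _) (E.bregman_nonneg hΘ (E.param_mem ha) (E.param_mem hμ))

/-- Time-uniform deviation inequality for the sum of the divergences of a set `S` of arms. -/
theorem IsBanditRun.measure_deviation_le [IsProbabilityMeasure P] (hrun : IsBanditRun E μ P A X)
    (hΘ : E.Θ.Nontrivial) (hμ : ∀ a, μ a ∈ E.meanSet) (S : Finset (Fin K)) {x : ℝ} (hx : 0 < x) :
    P {ω | ∃ t, (∀ a, count (fun s => A s ω) t a ≠ 0 ∧
        empMean (fun s => A s ω) (fun s => X s ω) t a ∈ E.meanSet) ∧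
      S.card * calT x ≤ ∑ a ∈ S, (armDiv E μ (fun s => A s ω) (fun s => X s ω) t a
        - 3 * Real.log (1 + Real.log (count (fun s => A s ω) t a)))}
      ≤ ENNReal.ofReal (Real.exp (-(S.card * x))) := by
  obtain ⟨C, η, hC, hCx, hη, hη', hcalT⟩ := exists_calT_eq hx
  have hC0 : 0 < C := one_pos.trans hC
  have hη0 : 0 < η := one_pos.trans hη
  -- The exponent `lam = 1 - 1 / C` maximises `(1 - lam) * exp (lam * C)`, with maximum `exp (C - 1
  -- - ln C) = exp x`.
  have hl0 : 0 < 1 - 1 / C := sub_pos.2 ((div_lt_one hC0).2 hC)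
  have hl1 : 1 - 1 / C < 1 := sub_lt_self _ (by positivity)
  choose f hf hfY using fun a =>
    E.exists_isTestFun hΘ (E.param_mem (hμ a)) hl0 hl1 hη hη'
  have hprob : ∀ a, IsProbabilityMeasure (E.arm (μ a)) := fun a =>
    E.isProbabilityMeasure_law (E.param_mem (hμ a))
  have hville := hrun.mul_measure_testProcess_le hprob hf S
    (ENNReal.ofReal (Real.exp (S.card * x)))
  refine (measure_mono (t := {ω | ∃ t, ENNReal.ofReal (Real.exp (S.card * x))
    ≤ testProcess f S (fun s => A s ω) (fun s => X s ω) t}) ?_).trans ?_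
  · rintro ω ⟨t, hω, hsum⟩
    refine ⟨t, ?_⟩
    set N := count (fun s => A s ω) t
    set D := armDiv E μ (fun s => A s ω) (fun s => X s ω) t with hD
    set Y : Fin K → ℝ := fun a => (D a - 3 * Real.log (1 + Real.log (N a))) / η
      - Real.log (2 * zetaTwo) + 2 * Real.log (Real.log η) with hY
    have hfa : ∀ a ∈ S, ENNReal.ofReal ((1 / C) * Real.exp ((1 - 1 / C) * Y a))
        ≤ f a (N a) (armSum (fun s => A s ω) (fun s => X s ω) t a) := by
      intro a _
      have h1 := hfY a (N a) (hω a).1 _ (E.param_mem (hω a).2)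
      have h2 : (N a : ℝ) * E.mean (E.param (empMean (fun s => A s ω) (fun s => X s ω) t a))
          = armSum (fun s => A s ω) (fun s => X s ω) t a := by
        rw [E.mean_param (hω a).2]
        exact mul_div_cancel₀ _ (Nat.cast_ne_zero.2 (hω a).1)
      rw [h2, sub_sub_cancel] at h1
      exact h1
    -- The terms of `calT x` other than `C` cancel the offsets in `Y` exactly, leaving an average of
    -- at least `C` per arm.
    have hYsum : S.card * C ≤ ∑ a ∈ S, Y a := by
      simp only [hY]
      rw [Finset.sum_add_distrib, Finset.sum_sub_distrib, ← Finset.sum_div, Finset.sum_const,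
        Finset.sum_const, nsmul_eq_mul, nsmul_eq_mul]
      have h3 := (div_le_div_iff_of_pos_right hη0).2 hsum
      have h4 : S.card * calT x / η
          = S.card * (C + Real.log (2 * zetaTwo) - 2 * Real.log (Real.log η)) := by
        rw [hcalT]
        field_simp
      rw [h4] at h3
      linarith
    refine le_trans ?_ (Finset.prod_le_prod' hfa)
    rw [← ENNReal.ofReal_prod_of_nonneg fun a _ => by positivity]
    refine ENNReal.ofReal_le_ofReal ?_
    have h5 : (1 / C : ℝ) = Real.exp (-Real.log C) := by
      rw [Real.exp_neg, Real.exp_log hC0, one_div]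
    rw [Finset.prod_mul_distrib, Finset.prod_const, ← Real.exp_sum, ← Finset.mul_sum]
    nth_rw 1 [h5]
    rw [← Real.exp_nat_mul, ← Real.exp_add, Real.exp_le_exp]
    have h6 := mul_le_mul_of_nonneg_left hYsum hl0.le
    have h7 : (1 - 1 / C) * (S.card * C) = S.card * (C - 1) := by
      field_simp
    have h8 : x = C - 1 - Real.log C := by linarith
    rw [h7] at h6
    rw [h8]
    linarith
  · set p := P {ω | ∃ t, ENNReal.ofReal (Real.exp (S.card * x))
      ≤ testProcess f S (fun s => A s ω) (fun s => X s ω) t}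
    calc p = ENNReal.ofReal (Real.exp (-(S.card * x)))
          * (ENNReal.ofReal (Real.exp (S.card * x)) * p) := by
            rw [← mul_assoc, ← ENNReal.ofReal_mul (Real.exp_pos _).le, ← Real.exp_add]
            simp
      _ ≤ _ := mul_le_of_le_one_right' hville

end Deviation

namespace IdentProblem

variable {E : ExpFamily} {K M : ℕ} (I : IdentProblem E K M)

/-! ### Geometry of the alternatives -/

theorem stopsAt_of_stoppingTime_eq {c : ℕ → ℝ} {A : ℕ → Fin K} {X : ℕ → ℝ} {t : ℕ}
    (h : I.stoppingTime c A X = (t : ℕ∞)) : I.stopsAt c A X t := by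
  have hlt : I.stoppingTime c A X < ((t + 1 : ℕ) : ℕ∞) := by
    rw [h]
    exact_mod_cast Nat.lt_succ_self t
  unfold stoppingTime at hlt
  obtain ⟨s, hs⟩ := iInf_lt_iff.1 hlt
  obtain ⟨hτ, hs⟩ := iInf_lt_iff.1 hs
  have hle : I.stoppingTime c A X ≤ s := iInf₂_le s hτ
  rw [h] at hle
  have h1 : t ≤ s := by exact_mod_cast hle
  have h2 : s < t + 1 := by exact_mod_cast hs
  rwa [show t = s by omega]

theorem mem_meanBox_of_mem_total {v : Fin K → ℝ} (hv : v ∈ I.total) : v ∈ E.meanBox K := by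
  obtain ⟨i, hi⟩ := Set.mem_iUnion.1 hv
  exact I.subset_box i hi

theorem eq_of_mem {v : Fin K → ℝ} {i j : Fin M} (hi : v ∈ I.O i) (hj : v ∈ I.O j) : i = j := by
  by_contra hne
  exact Set.disjoint_left.1 (I.disjoint i j hne) hi hj

/-- Fixing suitable `R` arms at their values under `μ` keeps a parameter among the limit points
of the alternatives to a hypothesis that `μ` does not satisfy. -/
theorem HasRank.exists_finset {R : ℕ} (hI : I.HasRank R) (hRK : R ≤ K) {μ : Fin K → ℝ}
    (hμ : μ ∈ I.total) {i : Fin M} (hi : μ ∉ I.O i) :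
    ∃ S : Finset (Fin K), S.card = R ∧ ∀ v ∈ E.meanBox K, (∀ a ∈ S, v a = μ a) →
      v ∈ closure (I.total \ I.O i) := by
  obtain ⟨Q, k, L, -, hL⟩ := hI
  obtain ⟨h1, h2⟩ := hL i
  obtain ⟨q, -, hq⟩ := Set.mem_iUnion.1 (h1 ⟨hμ, hi⟩)
  have hcard : (Finset.univ.image (k i q)).card ≤ R :=
    Finset.card_image_le.trans_eq (by simp)
  -- The arm indices may repeat, so their set is padded to exactly `R` arms; fixing more coordinates
  -- only strengthens the premise on `v`.
  obtain ⟨S, hS, -, hSR⟩ := Finset.exists_subsuperset_card_eq (Finset.subset_univ _) hcard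
    (by simpa using hRK)
  refine ⟨S, hSR, fun v hv hvS => h2 (Set.mem_iUnion.2 ⟨q, hv, ?_⟩)⟩
  have : (fun r => v (k i q r)) = fun r => μ (k i q r) := by
    ext r
    exact hvS _ (hS (Finset.mem_image_of_mem _ (Finset.mem_univ r)))
  rwa [this]

theorem diff_subset_alt {v : Fin K → ℝ} {i : Fin M} (hv : v ∈ I.O i) :
    I.total \ I.O i ⊆ I.alt v := by
  rintro w ⟨hw, hwi⟩
  obtain ⟨j, hj⟩ := Set.mem_iUnion.1 hw
  refine Set.mem_iUnion₂.2 ⟨j, fun hvj => hwi ?_, hj⟩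
  rwa [I.eq_of_mem hv hvj]

/-- The cost is continuous in the parameter on `ℐ^K`, so the infimum over the alternatives also
bounds it at their limit points in `ℐ^K`. -/
theorem glrStat_le (hΘ : E.Θ.Nontrivial) {A : ℕ → Fin K} {X : ℕ → ℝ} {t : ℕ} {i : Fin M}
    (hi : empMean A X t ∈ I.O i) {v : Fin K → ℝ} (hv : v ∈ E.meanBox K)
    (hvc : v ∈ closure (I.total \ I.O i)) :
    I.glrStat A X t ≤ ∑ a, (count A t a : ℝ≥0∞) * E.d (empMean A X t a) (v a) := by
  have hbox : empMean A X t ∈ E.meanBox K := I.subset_box i hi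
  have hsub : I.total \ I.O i ⊆ E.meanBox K := fun w hw => I.mem_meanBox_of_mem_total hw.1
  have hcont : ContinuousOn (fun w : Fin K → ℝ =>
      ∑ a, (count A t a : ℝ≥0∞) * E.d (empMean A X t a) (w a)) (E.meanBox K) := by
    refine continuousOn_finsetSum _ fun a _ => ?_
    refine (ENNReal.continuous_const_mul (ENNReal.natCast_ne_top _)).comp_continuousOn ?_
    exact (E.continuousOn_d hΘ (hbox a)).comp (continuous_apply a).continuousOn fun w hw => hw a
  have hne : (nhdsWithin v (I.total \ I.O i)).NeBot := mem_closure_iff_nhdsWithin_neBot.1 hvc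
  refine ge_of_tendsto ((hcont v hv).mono_left (nhdsWithin_mono v hsub)) ?_
  filter_upwards [self_mem_nhdsWithin] with w hw
  exact iInf₂_le w (I.diff_subset_alt hi hw)

/-- The competitor takes the values of `μ` on `S` and the empirical means elsewhere, where it costs
nothing. -/
theorem glrStat_le_sum_armDiv (hΘ : E.Θ.Nontrivial) {μ : Fin K → ℝ} (hμ : μ ∈ E.meanBox K)
    {A : ℕ → Fin K} {X : ℕ → ℝ} {t : ℕ} {i : Fin M} (hi : empMean A X t ∈ I.O i)
    {S : Finset (Fin K)} (hS : ∀ v ∈ E.meanBox K, (∀ a ∈ S, v a = μ a) →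
      v ∈ closure (I.total \ I.O i)) :
    I.glrStat A X t ≤ ENNReal.ofReal (∑ a ∈ S, armDiv E μ A X t a) := by
  have hbox : empMean A X t ∈ E.meanBox K := I.subset_box i hi
  have hv : S.piecewise μ (empMean A X t) ∈ E.meanBox K := by
    intro a
    by_cases ha : a ∈ S
    · simpa [ha] using hμ a
    · simpa [ha] using hbox a
  refine (I.glrStat_le hΘ hi hv (hS _ hv fun a ha => by simp [ha])).trans_eq ?_
  rw [ENNReal.ofReal_sum_of_nonneg fun a _ => armDiv_nonneg hΘ (hbox a) (hμ a)]
  rw [← Finset.sum_subset (Finset.subset_univ S) fun a _ ha => by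
    rw [Finset.piecewise_eq_of_notMem _ _ _ ha, E.d_self hΘ (hbox a), mul_zero]]
  refine Finset.sum_congr rfl fun a ha => ?_
  rw [Finset.piecewise_eq_of_mem _ _ _ ha, E.d_eq hΘ (hbox a) (hμ a), armDiv,
    ENNReal.ofReal_mul (Nat.cast_nonneg _), ENNReal.ofReal_natCast]

/-- An error makes the divergences of the `R` arms in `S` exceed their deviation bound. -/
theorem le_sum_armDiv_of_stopsAt (hΘ : E.Θ.Nontrivial) {R : ℕ} (hR : 1 ≤ R) {μ : Fin K → ℝ}
    (hμ : μ ∈ E.meanBox K) {δ : ℝ} {A : ℕ → Fin K} {X : ℕ → ℝ} {t : ℕ} {i : Fin M}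
    (hτ : I.stopsAt (rankThreshold R M δ) A X t)
    (hi : empMean A X t ∈ I.O i) {S : Finset (Fin K)} (hSR : S.card = R)
    (hS : ∀ v ∈ E.meanBox K, (∀ a ∈ S, v a = μ a) → v ∈ closure (I.total \ I.O i)) :
    S.card * calT (Real.log (((M : ℝ) - 1) / δ) / R) ≤ ∑ a ∈ S, (armDiv E μ A X t a
      - 3 * Real.log (1 + Real.log (count A t a))) := by
  have hbox : empMean A X t ∈ E.meanBox K := I.subset_box i hi
  obtain ⟨hN, -, hlt⟩ := hτ
  have hnonneg : 0 ≤ ∑ a ∈ S, armDiv E μ A X t a := Finset.sum_nonneg fun a _ =>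
    armDiv_nonneg hΘ (hbox a) (hμ a)
  have h1 := hlt.trans_le (EReal.coe_ennreal_le_coe_ennreal_iff.2
    (I.glrStat_le_sum_armDiv hΘ hμ hi hS))
  rw [EReal.coe_ennreal_ofReal, max_eq_left hnonneg, EReal.coe_lt_coe_iff] at h1
  have hSne : S.Nonempty := Finset.card_pos.1 (by omega)
  have hsum : ∑ a ∈ S, (count A t a : ℝ) ≤ t := by
    have := Finset.sum_le_univ_sum_of_nonneg (s := S) (f := count A t) fun a => Nat.zero_le _
    rw [sum_count] at this
    exact_mod_cast this
  -- Jensen replaces the `R` separate corrections by the single term `R ln(1 + ln(t/R))` of the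
  -- threshold, since the counts on `S` add up to at most `t`.
  have h2 := sum_log_one_add_log_le S hSne (fun a => (count A t a : ℝ)) t
    (fun a _ => by exact_mod_cast Nat.one_le_iff_ne_zero.2 (hN a)) hsum
  rw [hSR] at h2
  rw [Finset.sum_sub_distrib, ← Finset.mul_sum, hSR]
  unfold rankThreshold at h1
  linarith

/-- With at most one natural parameter there is at most one possible mean, so empirical means in `𝒪`
coincide with `μ`. This settles the case excluded by the derivative computation of the mean. -/
theorem not_errs_of_subsingleton (hΘ : E.Θ.Subsingleton) {μ : Fin K → ℝ} (hμ : μ ∈ I.total)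
    (c : ℕ → ℝ) (A : ℕ → Fin K) (X : ℕ → ℝ) : ¬ I.errs c μ A X := by
  rintro ⟨t, i, -, hi, hμi⟩
  have hs : E.meanSet.Subsingleton := hΘ.image _
  refine hμi ?_
  have : μ = empMean A X t := by
    ext a
    exact hs (I.mem_meanBox_of_mem_total hμ a) (I.subset_box i hi a)
  rw [this]
  exact hi

theorem errs_or_succeeds_of_ne_top {c : ℕ → ℝ} {μ : Fin K → ℝ} {A : ℕ → Fin K} {X : ℕ → ℝ}
    (h : I.stoppingTime c A X ≠ ⊤) : I.errs c μ A X ∨ I.succeeds c μ A X := by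
  obtain ⟨t, ht⟩ := ENat.ne_top_iff_exists.1 h
  obtain ⟨-, hm, -⟩ := I.stopsAt_of_stoppingTime_eq ht.symm
  obtain ⟨i, hi⟩ := Set.mem_iUnion.1 hm
  by_cases hμ : μ ∈ I.O i
  · exact Or.inr ⟨t, i, ht.symm, hi, hμ⟩
  · exact Or.inl ⟨t, i, ht.symm, hi, hμ⟩

/-! ### The error probability -/

theorem measure_errs_le {R : ℕ} (hR : 1 ≤ R) (hRK : R ≤ K) (hI : I.HasRank R) {δ : ℝ}
    (hδ0 : 0 < δ) (hδ1 : δ < 1) {Ω : Type*} [MeasurableSpace Ω] (P : Measure Ω)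
    [IsProbabilityMeasure P] {μ : Fin K → ℝ} (hμ : μ ∈ I.total) {A : ℕ → Ω → Fin K}
    {X : ℕ → Ω → ℝ} (hrun : IsBanditRun E μ P A X) :
    P {ω | I.errs (rankThreshold R M δ) μ (fun s => A s ω) (fun s => X s ω)}
      ≤ ENNReal.ofReal δ := by
  classical
  rcases Set.subsingleton_or_nontrivial E.Θ with hΘ | hΘ
  · simp [I.not_errs_of_subsingleton hΘ hμ]
  have hbox := I.mem_meanBox_of_mem_total hμ
  obtain ⟨i₀, hi₀⟩ := Set.mem_iUnion.1 hμ
  set W : Finset (Fin M) := Finset.univ.filter fun i => μ ∉ I.O i with hW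
  have hWcard : W.card ≤ M - 1 := by
    have hsub : W ⊆ Finset.univ.erase i₀ := fun i hi =>
      Finset.mem_erase.2 ⟨fun h => (Finset.mem_filter.1 hi).2 (h ▸ hi₀), Finset.mem_univ i⟩
    simpa using Finset.card_le_card hsub
  have hS : ∀ i : Fin M, ∃ S : Finset (Fin K), μ ∉ I.O i → S.card = R ∧ ∀ v ∈ E.meanBox K,
      (∀ a ∈ S, v a = μ a) → v ∈ closure (I.total \ I.O i) := fun i => by
    by_cases hi : μ ∈ I.O i
    · exact ⟨∅, fun h => absurd hi h⟩
    · obtain ⟨S, h⟩ := hI.exists_finset I hRK hμ hi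
      exact ⟨S, fun _ => h⟩
  -- The sets `S i` are fixed before any data are seen, so the union bound runs over wrong indices
  -- only, not over times or over the pieces of the rank decomposition.
  choose S hS using hS
  set x := Real.log (((M : ℝ) - 1) / δ) / R with hx
  set B : Fin M → Set Ω := fun i =>
    {ω | ∃ t, (∀ a, count (fun s => A s ω) t a ≠ 0 ∧
        empMean (fun s => A s ω) (fun s => X s ω) t a ∈ E.meanSet) ∧
      (S i).card * calT x ≤ ∑ a ∈ S i, (armDiv E μ (fun s => A s ω) (fun s => X s ω) t a
        - 3 * Real.log (1 + Real.log (count (fun s => A s ω) t a)))} with hB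
  have hsub : {ω | I.errs (rankThreshold R M δ) μ (fun s => A s ω) (fun s => X s ω)}
      ⊆ ⋃ i ∈ W, B i := by
    rintro ω ⟨t, i, ht, hi, hμi⟩
    have hτ := I.stopsAt_of_stoppingTime_eq ht
    obtain ⟨hSR, hSi⟩ := hS i hμi
    refine Set.mem_iUnion₂.2 ⟨i, by simpa [hW] using hμi, t,
      fun a => ⟨hτ.1 a, I.subset_box i hi a⟩, ?_⟩
    exact I.le_sum_armDiv_of_stopsAt hΘ hR hbox hτ hi hSR hSi
  refine (measure_mono hsub).trans ((measure_biUnion_finset_le W B).trans ?_)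
  -- The empty case includes `M = 1`, where the logarithm in the threshold has no meaning.
  rcases W.eq_empty_or_nonempty with hWe | hWne
  · simp [hWe]
  have hM : (1 : ℝ) ≤ (M : ℝ) - 1 := by
    have h1 : 2 ≤ M := by
      have := hWne.card_pos
      omega
    have h2 : (2 : ℝ) ≤ M := by exact_mod_cast h1
    linarith
  have hR0 : (0 : ℝ) < R := by exact_mod_cast hR
  have hMδ : 1 < ((M : ℝ) - 1) / δ := (one_lt_div hδ0).2 (hδ1.trans_le hM)
  have hx0 : 0 < x := div_pos (Real.log_pos hMδ) hR0
  have hBi : ∀ i ∈ W, P (B i) ≤ ENNReal.ofReal (δ / ((M : ℝ) - 1)) := by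
    intro i hi
    refine (hrun.measure_deviation_le hΘ hbox (S i) hx0).trans_eq ?_
    rw [(hS i (Finset.mem_filter.1 hi).2).1, hx, mul_div_cancel₀ _ hR0.ne', Real.exp_neg,
      Real.exp_log (one_pos.trans hMδ), inv_div]
  refine (Finset.sum_le_card_nsmul W _ _ hBi).trans ?_
  rw [nsmul_eq_mul, ← ENNReal.ofReal_natCast, ← ENNReal.ofReal_mul (Nat.cast_nonneg _)]
  refine ENNReal.ofReal_le_ofReal ?_
  have hWM : (W.card : ℝ) ≤ (M : ℝ) - 1 := by
    have h1 : W.card + 1 ≤ M := by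
      have := hWne.card_pos
      omega
    have h2 : (W.card : ℝ) + 1 ≤ M := by exact_mod_cast h1
    linarith
  calc (W.card : ℝ) * (δ / ((M : ℝ) - 1)) ≤ ((M : ℝ) - 1) * (δ / ((M : ℝ) - 1)) := by gcongr
    _ = δ := mul_div_cancel₀ _ (by linarith)

end IdentProblem

end GLR

/-! ### From the error bound to `δ`-correctness -/

theorem proposition6p2 (E : GLR.ExpFamily) (K M R : ℕ) (hR : 1 ≤ R) (hRK : R ≤ K)
    (I : GLR.IdentProblem E K M) (hI : I.HasRank R) (δ : ℝ) (hδ0 : 0 < δ) (hδ1 : δ < 1)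
    {Ω : Type*} [MeasurableSpace Ω] (P : MeasureTheory.Measure Ω)
    [MeasureTheory.IsProbabilityMeasure P]
    (μ : Fin K → ℝ) (hμ : μ ∈ I.total) (A : ℕ → Ω → Fin K) (X : ℕ → Ω → ℝ)
    (hrun : GLR.IsBanditRun E μ P A X) :
    GLR.IsDeltaCorrect I (GLR.rankThreshold R M δ) δ P μ A X := by
  have herr := I.measure_errs_le hR hRK hI hδ0 hδ1 P hμ hrun
  refine ⟨herr, fun hτ => ?_⟩
  -- Almost surely the rule errs or succeeds. Subadditivity of `P` is used instead of complements,
  -- so neither event has to be shown measurable.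
  have h1 : (1 : ℝ≥0∞) ≤ ENNReal.ofReal δ
      + P {ω | I.succeeds (GLR.rankThreshold R M δ) μ (fun s => A s ω) (fun s => X s ω)} := by
    rw [← measure_univ (μ := P)]
    refine (measure_mono_ae ?_).trans ((measure_union_le _ _).trans (add_le_add herr le_rfl))
    filter_upwards [hτ] with ω hω _
    exact I.errs_or_succeeds_of_ne_top hω
  rw [ENNReal.ofReal_sub 1 hδ0.le, ENNReal.ofReal_one]
  exact tsub_le_iff_left.2 h1
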